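/- Notation. Let $\mathbb T=\mathbb R/2\pi\mathbb Z$. For $s>0$ let $E_s$ be the Banach space of $2\pi$-periodic functions that are continuous and bounded on the closed strip $\{|\operatorname{Im} z|\le s\}$ and holomorphic in $\{|\operatorname{Im} z|<s\}$, with the sup norm; $\mathcal H(\Omega,E)$ denotes the holomorphic maps from $\Omega$ to $E$. Let $u^{+}=\max(0,u)$, $u^{-}=\max(0,-u)$. Data. Let $0<s_0<r$, $a>0$, $n\in\mathbb N$, $\alpha\in(0,1]$, and let $\phi\in C_c^\infty(\mathbb R)$ be real with $\int\phi=1$; put $\phi_h(y)=h^{-1}\phi(y/h)$. For $0<\epsilon<1$ let $v_0^\epsilon,w_0^\epsilon$ be $2\pi$-periodic and holomorphic in $\{|\operatorname{Im} z|<r\}$ and let $u^\epsilon(z,t)$ be holomorphic in $\{|\operatorname{Im} z|<r\}\times\{t\in\mathbb C:|t|<a\}$ and $2\pi$-periodic in $z$. Assume, uniformly in $\epsilon$, that $|v_0^\epsilon|,|w_0^\epsilon|\le B$ on $\{|\operatorname{Im} z|\le s_0\}$ and $|u^\epsilon|\le M$ on $\{|\operatorname{Im} z|\le s_0\}\times\{|t|<a\}$.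 Assume that $u^\epsilon$ is real for real $(x,t)$ and has there a fixed sign $\sigma\in\{1,-1\}$ away from $0$: $\sigma u^\epsilon(x,t)\ge\eta>0$ for all $\epsilon$, $x\in\mathbb R$, $t\in(-a,a)$. Finally let $v_0,w_0$ and, for each $t\in[0,a)$, $u(\cdot,t)$ (real valued) be continuous functions on $\mathbb T$ such that, as $\epsilon\to0^+$, $v_0^\epsilon\to v_0$, $w_0^\epsilon\to w_0$ and $u^\epsilon(\cdot,t)\to u(\cdot,t)$ in $L^1(\mathbb T)$. Equations. Consider in $C_b(\mathbb R)$ the linear ODEs $$\tfrac{d}{dt}X^\epsilon(x,t)=\tfrac1\epsilon\big[(X^\epsilon u^{\epsilon+})(x-\epsilon,t)-(X^\epsilon|u^\epsilon|)(x,t)+(X^\epsilon u^{\epsilon-})(x+\epsilon,t)\big],\quad X^\epsilon(x,0)=v_0^\epsilon(x),\tag{A}$$ $$\tfrac{d}{dt}w^\epsilon(x,t)=\tfrac1\epsilon\big[(w^\epsilon u^{\epsilon+})(x-\epsilon,t)-(w^\epsilon|u^\epsilon|)(x,t)+(w^\epsilon u^{\epsilon-})(x+\epsilon,t)\big]-n(v^\epsilon)^{n-1}\tfrac{\partial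 v^\epsilon}{\partial x}(x,t),\quad w^\epsilon(x,0)=w_0^\epsilon(x),\tag{B}$$ with $v^\epsilon(\cdot,t)=X^\epsilon(\cdot,t)*\phi_{\epsilon^\alpha}$. Since $u^\epsilon$ has the sign $\sigma$, the bracket terms are $-\frac{\sigma}{\epsilon}[(Xu^\epsilon)(x,t)-(Xu^\epsilon)(x-\sigma\epsilon,t)]$, $X=X^\epsilon$ or $w^\epsilon$ (for $\sigma=1$, (A) reads $\partial_tX^\epsilon=-\frac1\epsilon[(X^\epsilon u^\epsilon)(x,t)-(X^\epsilon u^\epsilon)(x-\epsilon,t)]$), and in this form (A), (B) make sense for $x=z$ in a complex strip and complex $t$. Theorem. There is $C>0$ depending only on $M$ such that, for all data as above and every $0<s<s_0$, with $\delta=\min(a,C(s_0-s))$: (1) for every $\epsilon\in(0,1)$, (A) and (B) in complex form have unique solutions $X^\epsilon,w^\epsilon\in\mathcal H(\{|t|<\delta\},E_s)$; for $t\in[0,\delta)$ their restrictions to the real axis are the unique solutions of (A), (B) in $C_b(\mathbb R)$; (2) for every $\rho<\delta$, $\|X^\epsilon(t)\|_{E_s}$ and $\|w^\epsilon(t)\|_{E_s}$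 are bounded uniformly in $\epsilon\in(0,1)$ and $|t|\le\rho$; (3) there are $X,w\in\mathcal H(\{|t|<\delta\},E_s)$ (same $\delta$) whose restrictions to $\mathbb R\times[0,\delta)$ are classical solutions of $$\partial_tX=-\partial_x(Xu),\quad X(x,0)=v_0(x),\qquad\qquad \partial_tw=-\partial_x(wu)-\partial_x(X^n),\quad w(x,0)=w_0(x),$$ and are the only $2\pi$-periodic $C^1$ solutions on $\mathbb R\times[0,\delta)$; (4) as $\epsilon\to0^+$, $X^\epsilon\to X$ and $w^\epsilon\to w$ uniformly on the compact subsets of $\{|\operatorname{Im} z|<s\}\times\{|t|<\delta\}$ (in particular on the compact subsets of $\mathbb T\times[0,\delta)$). -/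

import Mathlib

open Set Filter Topology MeasureTheory
open scoped BoundedContinuousFunction

noncomputable section

namespace WeakAsymptotic

/-- The open horizontal strip `|Im z| < s`. -/
def strip (s : ℝ) : Set ℂ := {z | |z.im| < s}

/-- The closed horizontal strip `|Im z| ≤ s`. -/
def closedStrip (s : ℝ) : Set ℂ := {z | |z.im| ≤ s}

/-- A function on the closed strip, read as a function on `ℂ` (with value `0` off the strip). -/
def evalStrip {s : ℝ} (f : closedStrip s →ᵇ ℂ) (z : ℂ) : ℂ :=
  open Classical in if h : z ∈ closedStrip s then f ⟨z, h⟩ else 0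

lemma evalStrip_of_mem {s : ℝ} (f : closedStrip s →ᵇ ℂ) {z : ℂ} (h : z ∈ closedStrip s) :
    evalStrip f z = f ⟨z, h⟩ := by
  simp [evalStrip, h]

lemma strip_subset_closedStrip (s : ℝ) : strip s ⊆ closedStrip s :=
  fun z (hz : |z.im| < s) => (le_of_lt hz : |z.im| ≤ s)

lemma isOpen_strip (s : ℝ) : IsOpen (strip s) :=
  isOpen_lt (by fun_prop) continuous_const

/-- The space `E_s`: bounded continuous `2π`-periodic functions on the closed strip `|Im z| ≤ s`
that are holomorphic in the open strip, with the sup norm. -/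
def StripSpace (s : ℝ) : Submodule ℂ (closedStrip s →ᵇ ℂ) where
  carrier := {f | (∀ z w : closedStrip s, (w : ℂ) = (z : ℂ) + 2 * Real.pi → f w = f z) ∧
    DifferentiableOn ℂ (evalStrip f) (strip s)}
  zero_mem' := by
    refine ⟨fun _ _ _ => rfl, ?_⟩
    refine (differentiableOn_const (0 : ℂ)).congr fun z hz => ?_
    simp [evalStrip_of_mem _ (strip_subset_closedStrip s hz)]
  add_mem' := by
    rintro f g ⟨hf, hf'⟩ ⟨hg, hg'⟩
    refine ⟨fun z w h => by simp [hf z w h, hg z w h], ?_⟩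
    refine (hf'.add hg').congr fun z hz => ?_
    simp [evalStrip_of_mem _ (strip_subset_closedStrip s hz)]
  smul_mem' := by
    rintro c f ⟨hf, hf'⟩
    refine ⟨fun z w h => by simp [hf z w h], ?_⟩
    refine (hf'.const_smul c).congr fun z hz => ?_
    simp [evalStrip_of_mem _ (strip_subset_closedStrip s hz)]

/-- `E_s` is a Banach space. -/
instance (s : ℝ) : CompleteSpace (StripSpace s) := by
  suffices h : IsClosed (StripSpace s : Set (closedStrip s →ᵇ ℂ)) from h.completeSpace_coe
  refine IsSeqClosed.isClosed fun f g hf hfg => ?_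
  have hu := BoundedContinuousFunction.tendsto_iff_tendstoUniformly.1 hfg
  refine ⟨fun z w h => ?_, ?_⟩
  · refine tendsto_nhds_unique (hu.tendsto_at w) ?_
    have := hu.tendsto_at z
    refine this.congr fun k => ((hf k).1 z w h).symm
  · have hloc : TendstoLocallyUniformlyOn (fun k => evalStrip (f k)) (evalStrip g) atTop
        (strip s) := by
      refine TendstoUniformlyOn.tendstoLocallyUniformlyOn ?_
      rw [Metric.tendstoUniformlyOn_iff]
      rw [Metric.tendstoUniformly_iff] at hu
      intro e he
      filter_upwards [hu e he] with k hk z hz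
      have hz' := strip_subset_closedStrip s hz
      rw [evalStrip_of_mem _ hz', evalStrip_of_mem _ hz']
      exact hk ⟨z, hz'⟩
    exact hloc.differentiableOn (Eventually.of_forall fun k => (hf k).2) (isOpen_strip s)

/-- The value `f(z)` of an element of `E_s`, for `|Im z| ≤ s`. -/
def val {s : ℝ} (f : StripSpace s) (z : ℂ) : ℂ := evalStrip (f : closedStrip s →ᵇ ℂ) z

/-- The restriction of an element of `E_s` to the real axis, in `C_b(ℝ)`. -/
def restrictReal {s : ℝ} (hs : 0 < s) (f : StripSpace s) : ℝ →ᵇ ℂ :=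
  (f : closedStrip s →ᵇ ℂ).compContinuous
    ⟨fun x => ⟨(x : ℂ), by simpa [closedStrip] using hs.le⟩, by fun_prop⟩

/-! ### The approximating differential equations -/

/-- The convolution `g * φ_h` on the real line, where `φ_h(y) = φ(y/h)/h`. -/
def mollify (φ : ℝ → ℝ) (h : ℝ) (g : ℝ → ℂ) (x : ℝ) : ℂ :=
  ∫ y : ℝ, g (x - y) * ((h⁻¹ * φ (y / h) : ℝ) : ℂ)

/-- The same convolution (along the real direction) for functions of a complex variable. -/
def mollifyC (φ : ℝ → ℝ) (h : ℝ) (g : ℂ → ℂ) (z : ℂ) : ℂ :=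
  ∫ y : ℝ, g (z - y) * ((h⁻¹ * φ (y / h) : ℝ) : ℂ)

/-- `∂(vⁿ)/∂x = n vⁿ⁻¹ ∂v/∂x` for `v = g * φ_h`, on the real line. -/
def pressureGrad (n : ℕ) (φ : ℝ → ℝ) (h : ℝ) (g : ℝ → ℂ) (x : ℝ) : ℂ :=
  n * mollify φ h g x ^ (n - 1) * deriv (mollify φ h g) x

/-- `∂(vⁿ)/∂z = n vⁿ⁻¹ ∂v/∂z` for `v = g * φ_h`, in the complex domain. -/
def pressureGradC (n : ℕ) (φ : ℝ → ℝ) (h : ℝ) (g : ℂ → ℂ) (z : ℂ) : ℂ :=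
  n * mollifyC φ h g z ^ (n - 1) * deriv (mollifyC φ h g) z

/-- `t ↦ X(t)` is a solution on `[0, T)`, in the Banach space `C_b(ℝ)`, of
`dX/dt (x,t) = ε⁻¹ [(X u⁺)(x-ε,t) - (X |u|)(x,t) + (X u⁻)(x+ε,t)] - f(x,t)`, `X(x,0) = g₀(x)`,
where `u⁺ = max 0 u`, `u⁻ = max 0 (-u)`. -/
structure SolvesUpwindODE (ε T : ℝ) (u : ℝ → ℝ → ℝ) (f : ℝ → ℝ → ℂ) (g₀ : ℝ → ℂ)
    (X : ℝ → ℝ →ᵇ ℂ) : Prop where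
  init : ∀ x, X 0 x = g₀ x
  ode : ∀ t ∈ Ico 0 T, ∃ D : ℝ →ᵇ ℂ, HasDerivWithinAt X D (Ici 0) t ∧
    ∀ x, D x = (1 / (ε : ℂ)) * (X t (x - ε) * ((max 0 (u (x - ε) t) : ℝ) : ℂ)
        - X t x * ((|u x t| : ℝ) : ℂ)
        + X t (x + ε) * ((max 0 (-u (x + ε) t) : ℝ) : ℂ)) - f x t

/-- `X ∈ H({|t| < δ}, E_s)` solves, for a coefficient `u` of constant sign `σ = ±1`,
`dX/dt (z,t) = -(σ/ε) [(X u)(z,t) - (X u)(z - σε,t)] - f(z,t)`, `X(z,0) = g₀(z)`.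
For `σ = 1` the difference quotient is taken to the left, for `σ = -1` to the right. -/
structure SolvesStripODE (σ ε δ : ℝ) {s : ℝ} (u f : ℂ → ℂ → ℂ) (g₀ : ℂ → ℂ)
    (X : ℂ → StripSpace s) : Prop where
  holo : DifferentiableOn ℂ X (Metric.ball 0 δ)
  init : ∀ z ∈ closedStrip s, val (X 0) z = g₀ z
  ode : ∀ t ∈ Metric.ball (0 : ℂ) δ, ∀ z ∈ strip s,
    val (deriv X t) z = -((σ : ℂ) / ε) *
      (val (X t) z * u z t - val (X t) (z - σ * ε) * u (z - σ * ε) t) - f z t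

/-! ### The limiting partial differential equation -/

/-- `Y` is a classical (`C¹`, `2π`-periodic in `x`) solution on `ℝ × [0, δ)` of
`∂Y/∂t = -∂(Y u)/∂x - f`, `Y(x,0) = g₀(x)`. -/
structure IsClassicalSolution (δ : ℝ) (u : ℝ → ℝ → ℝ) (f : ℝ → ℝ → ℂ) (g₀ : ℝ → ℂ)
    (Y : ℝ → ℝ → ℂ) : Prop where
  periodic : ∀ t ∈ Ico 0 δ, Function.Periodic (fun x => Y x t) (2 * Real.pi)
  contDiffOn : ContDiffOn ℝ 1 (Function.uncurry Y) (univ ×ˢ Ico 0 δ)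
  init : ∀ x, Y x 0 = g₀ x
  pde : ∀ x, ∀ t ∈ Ico 0 δ, ∃ d : ℂ, HasDerivAt (fun ξ => Y ξ t * (u ξ t : ℂ)) d x ∧
    HasDerivWithinAt (Y x) (-d - f x t) (Ici 0) t

/-! ### The assumptions -/

/-- An initial datum holomorphic and `2π`-periodic on the strip `|Im z| < r` and bounded by `B` on
`|Im z| ≤ s₀`, uniformly for `0 < ε < 1`. -/
structure AnalyticDatum (r s₀ B : ℝ) (g : ℝ → ℂ → ℂ) : Prop where
  holo : ∀ ε ∈ Ioo (0 : ℝ) 1, DifferentiableOn ℂ (g ε) (strip r)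
  periodic : ∀ ε ∈ Ioo (0 : ℝ) 1, ∀ z ∈ strip r, g ε (z + 2 * Real.pi) = g ε z
  bounded : ∀ ε ∈ Ioo (0 : ℝ) 1, ∀ z ∈ closedStrip s₀, ‖g ε z‖ ≤ B

/-- A coefficient `u^ε(z,t)` holomorphic for `|Im z| < r`, `|t| < a`, `2π`-periodic in `z`, bounded
by `M` for `|Im z| ≤ s₀`, `|t| < a`, uniformly for `0 < ε < 1`, real for real arguments, and there
of constant sign `σ` and at distance at least `η` from `0`. -/
structure AnalyticCoefficient (r s₀ a M σ η : ℝ) (u : ℝ → ℂ → ℂ → ℂ) : Prop where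
  holo : ∀ ε ∈ Ioo (0 : ℝ) 1,
    DifferentiableOn ℂ (Function.uncurry (u ε)) (strip r ×ˢ Metric.ball 0 a)
  periodic : ∀ ε ∈ Ioo (0 : ℝ) 1, ∀ z ∈ strip r, ∀ t ∈ Metric.ball (0 : ℂ) a,
    u ε (z + 2 * Real.pi) t = u ε z t
  bounded : ∀ ε ∈ Ioo (0 : ℝ) 1, ∀ z ∈ closedStrip s₀, ∀ t ∈ Metric.ball (0 : ℂ) a,
    ‖u ε z t‖ ≤ M
  real : ∀ ε ∈ Ioo (0 : ℝ) 1, ∀ x t : ℝ, |t| < a → (u ε x t).im = 0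
  sign : ∀ ε ∈ Ioo (0 : ℝ) 1, ∀ x t : ℝ, |t| < a → η ≤ σ * (u ε x t).re

/-- `g` is continuous and `2π`-periodic and `g^ε → g` in `L¹(𝕋)` as `ε → 0⁺`. -/
structure ConvergesL1Torus (gε : ℝ → ℝ → ℂ) (g : ℝ → ℂ) : Prop where
  continuous : Continuous g
  periodic : Function.Periodic g (2 * Real.pi)
  tendsto : Tendsto (fun ε => ∫ x in (-Real.pi)..Real.pi, ‖gε ε x - g x‖) (𝓝[>] 0) (𝓝 0)

/-- `F^ε → F` uniformly on the compact subsets of `{|Im z| < s} × {|t| < δ}` as `ε → 0⁺`. -/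
def ConvergesOnCompacts (δ : ℝ) {s : ℝ} (Fε : ℝ → ℂ → StripSpace s) (F : ℂ → StripSpace s) :
    Prop :=
  ∀ Q : Set (ℂ × ℂ), IsCompact Q → Q ⊆ strip s ×ˢ Metric.ball 0 δ →
    TendstoUniformlyOn (fun ε p => val (Fε ε p.2) p.1) (fun p => val (F p.2) p.1) (𝓝[>] 0) Q

/-- `F^ε(t)` is bounded in `E_s` uniformly in `0 < ε < 1` and in `t` on smaller discs. -/
def UniformlyBounded (δ : ℝ) {s : ℝ} (Fε : ℝ → ℂ → StripSpace s) : Prop :=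
  ∀ ρ < δ, ∃ B : ℝ, ∀ ε ∈ Ioo (0 : ℝ) 1, ∀ t : ℂ, ‖t‖ ≤ ρ → ‖Fε ε t‖ ≤ B

end WeakAsymptotic

end

/-!
The upwind difference quotient `f ↦ ε⁻¹ (f - f(· - σε))` costs a derivative, but by Cauchy's
estimate it maps `E_{s'}` to `E_s`, `s < s'`, with norm at most `1 / (s' - s)`, whatever `ε` is.
Measure the `k`-th Picard correction by the `k`-th power of the distance to the boundary of the
strip, and give up the fraction `1 / (k + 2)` of that distance in the next step. Since
`((k + 2) / (k + 1)) ^ (k + 1) ≤ e`, the correction is at most a multiple of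
`(e M |t| / (s' - |Im z|)) ^ k`, and these form a geometric series as soon as
`2 e M |t| ≤ s' - s`. This solves both equations on a time interval independent of `ε`, with bounds
independent of `ε`.

A bounded family of holomorphic functions has a pointwise limit along every ultrafilter, locally
uniformly with its derivatives. Along each ultrafilter finer than `ε → 0⁺` the difference quotient
therefore tends to a derivative and the limit solves the limiting equation. The latter has only one
classical solution, since `max_x |Y(x, t)|²` satisfies a Gronwall inequality in which the transport
term vanishes at a maximum. All ultrafilters thus give the same limit, and this is convergence.
-/

noncomputable section

namespace WeakAsymptotic

/-! ### Strips -/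

lemma mem_strip {s : ℝ} {z : ℂ} : z ∈ strip s ↔ |z.im| < s := Iff.rfl

lemma mem_closedStrip {s : ℝ} {z : ℂ} : z ∈ closedStrip s ↔ |z.im| ≤ s := Iff.rfl

lemma closedStrip_subset_strip {s s' : ℝ} (h : s < s') : closedStrip s ⊆ strip s' :=
  fun _ hz => mem_strip.2 ((mem_closedStrip.1 hz).trans_lt h)

lemma closedStrip_mono {s s' : ℝ} (h : s ≤ s') : closedStrip s ⊆ closedStrip s' :=
  fun _ hz => mem_closedStrip.2 ((mem_closedStrip.1 hz).trans h)

lemma strip_mono {s s' : ℝ} (h : s ≤ s') : strip s ⊆ strip s' :=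
  fun _ hz => mem_strip.2 ((mem_strip.1 hz).trans_le h)

lemma sub_ofReal_mem_strip {s : ℝ} {z : ℂ} (hz : z ∈ strip s) (y : ℝ) : z - y ∈ strip s := by
  simpa [mem_strip] using hz

lemma sub_ofReal_mem_closedStrip {s : ℝ} {z : ℂ} (hz : z ∈ closedStrip s) (y : ℝ) :
    z - y ∈ closedStrip s := by
  simpa [mem_closedStrip] using hz

lemma add_two_pi_mem_closedStrip {s : ℝ} {z : ℂ} (hz : z ∈ closedStrip s) :
    z + 2 * Real.pi ∈ closedStrip s := by
  simpa [mem_closedStrip] using hz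

lemma ofReal_mem_strip {s : ℝ} (hs : 0 < s) (x : ℝ) : (x : ℂ) ∈ strip s := by
  simpa [mem_strip] using hs

lemma ofReal_mem_closedStrip {s : ℝ} (hs : 0 ≤ s) (x : ℝ) : (x : ℂ) ∈ closedStrip s := by
  simpa [mem_closedStrip] using hs

lemma abs_im_le_abs_im_add_dist (z w : ℂ) : |w.im| ≤ |z.im| + dist w z := by
  have h : |w.im - z.im| ≤ dist w z := by
    rw [dist_eq_norm, ← Complex.sub_im]
    exact Complex.abs_im_le_norm _
  linarith [abs_sub_abs_le_abs_sub w.im z.im]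

lemma closedBall_subset_closedStrip {s R : ℝ} {z : ℂ} (h : |z.im| + R ≤ s) :
    Metric.closedBall z R ⊆ closedStrip s := fun w hw =>
  mem_closedStrip.2 (by linarith [abs_im_le_abs_im_add_dist z w, Metric.mem_closedBall.1 hw])

lemma ball_subset_strip {s R : ℝ} {z : ℂ} (h : |z.im| + R ≤ s) :
    Metric.ball z R ⊆ strip s := fun w hw =>
  mem_strip.2 (by linarith [abs_im_le_abs_im_add_dist z w, Metric.mem_ball.1 hw])

lemma closedStrip_subset_closure_strip {s : ℝ} (hs : 0 < s) :
    closedStrip s ⊆ closure (strip s) := by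
  intro z hz
  have hlim : Tendsto (fun θ : ℝ => (z.re : ℂ) + (θ * z.im : ℝ) * Complex.I) (𝓝[<] 1) (𝓝 z) := by
    have h : Continuous (fun θ : ℝ => (z.re : ℂ) + (θ * z.im : ℝ) * Complex.I) := by fun_prop
    simpa using (h.tendsto 1).mono_left nhdsWithin_le_nhds
  refine mem_closure_of_tendsto hlim ?_
  filter_upwards [Ioo_mem_nhdsLT (zero_lt_one' ℝ)] with θ hθ
  have him : ((z.re : ℂ) + (θ * z.im : ℝ) * Complex.I).im = θ * z.im := by simp
  rw [mem_strip, him, abs_mul, abs_of_pos hθ.1]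
  nlinarith [hθ.1, hθ.2, mem_closedStrip.1 hz, abs_nonneg z.im]

lemma convex_strip (s : ℝ) : Convex ℝ (strip s) := by
  have h : strip s = Complex.imLm ⁻¹' Ioo (-s) s := by
    ext z
    simp [mem_strip, abs_lt]
  rw [h]
  exact (convex_Ioo (-s) s).linear_preimage Complex.imLm

lemma convex_closedStrip (s : ℝ) : Convex ℝ (closedStrip s) := by
  have h : closedStrip s = Complex.imLm ⁻¹' Icc (-s) s := by
    ext z
    simp [mem_closedStrip, abs_le]
  rw [h]
  exact (convex_Icc (-s) s).linear_preimage Complex.imLm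

/-! ### Elements of `E_s` as functions -/

/-- `g` is the restriction of an element of `E_s` of norm at most `K`. -/
structure IsStripFunction (s K : ℝ) (g : ℂ → ℂ) : Prop where
  continuousOn : ContinuousOn g (closedStrip s)
  differentiableOn : DifferentiableOn ℂ g (strip s)
  periodic : ∀ z ∈ closedStrip s, g (z + 2 * Real.pi) = g z
  norm_le : ∀ z ∈ closedStrip s, ‖g z‖ ≤ K

namespace IsStripFunction

variable {s s' K L : ℝ} {f g : ℂ → ℂ}

lemma mono (hg : IsStripFunction s' K g) (hs : s ≤ s') : IsStripFunction s K g where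
  continuousOn := hg.continuousOn.mono (closedStrip_mono hs)
  differentiableOn := hg.differentiableOn.mono (strip_mono hs)
  periodic z hz := hg.periodic z (closedStrip_mono hs hz)
  norm_le z hz := hg.norm_le z (closedStrip_mono hs hz)

lemma mono_bound (hg : IsStripFunction s K g) (h : K ≤ L) : IsStripFunction s L g :=
  { hg with norm_le := fun z hz => (hg.norm_le z hz).trans h }

lemma nonneg (hg : IsStripFunction s K g) (hs : 0 ≤ s) : 0 ≤ K :=
  (norm_nonneg _).trans (hg.norm_le 0 (by simpa [mem_closedStrip] using hs))

lemma mul (hf : IsStripFunction s K f) (hg : IsStripFunction s L g) (hK : 0 ≤ K) :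
    IsStripFunction s (K * L) (fun z => f z * g z) where
  continuousOn := hf.continuousOn.mul hg.continuousOn
  differentiableOn := hf.differentiableOn.mul hg.differentiableOn
  periodic z hz := by rw [hf.periodic z hz, hg.periodic z hz]
  norm_le z hz := by
    rw [norm_mul]
    exact mul_le_mul (hf.norm_le z hz) (hg.norm_le z hz) (norm_nonneg _) hK

lemma const_mul (hg : IsStripFunction s K g) (c : ℂ) :
    IsStripFunction s (‖c‖ * K) (fun z => c * g z) where
  continuousOn := hg.continuousOn.const_mul c
  differentiableOn := hg.differentiableOn.const_mul c
  periodic z hz := by rw [hg.periodic z hz]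
  norm_le z hz := by
    rw [norm_mul]
    exact mul_le_mul_of_nonneg_left (hg.norm_le z hz) (norm_nonneg c)

lemma pow (hg : IsStripFunction s K g) (n : ℕ) : IsStripFunction s (K ^ n) (fun z => g z ^ n) where
  continuousOn := hg.continuousOn.pow n
  differentiableOn := hg.differentiableOn.pow n
  periodic z hz := by rw [hg.periodic z hz]
  norm_le z hz := by
    rw [norm_pow]
    exact pow_le_pow_left₀ (norm_nonneg _) (hg.norm_le z hz) n

lemma shift (hg : IsStripFunction s K g) (y : ℝ) : IsStripFunction s K (fun z => g (z - y)) where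
  continuousOn :=
    hg.continuousOn.comp (by fun_prop) fun _ hz => sub_ofReal_mem_closedStrip hz y
  differentiableOn := hg.differentiableOn.comp (by fun_prop) fun _ hz => sub_ofReal_mem_strip hz y
  periodic z hz := by
    rw [add_sub_right_comm]
    exact hg.periodic _ (sub_ofReal_mem_closedStrip hz y)
  norm_le z hz := hg.norm_le _ (sub_ofReal_mem_closedStrip hz y)

lemma diffContOnCl_ball (hg : IsStripFunction s K g) {z : ℂ} {R : ℝ} (h : |z.im| + R ≤ s) :
    DiffContOnCl ℂ g (Metric.ball z R) :=
  ⟨hg.differentiableOn.mono (ball_subset_strip h), hg.continuousOn.mono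
    (Metric.closure_ball_subset_closedBall.trans (closedBall_subset_closedStrip h))⟩

lemma norm_deriv_le (hg : IsStripFunction s' K g) (hs : s < s') {z : ℂ} (hz : z ∈ closedStrip s) :
    ‖deriv g z‖ ≤ K / (s' - s) := by
  have hR : |z.im| + (s' - s) ≤ s' := by linarith [mem_closedStrip.1 hz]
  exact Complex.norm_deriv_le_of_forall_mem_sphere_norm_le (sub_pos.2 hs) (hg.diffContOnCl_ball hR)
    fun w hw => hg.norm_le w (closedBall_subset_closedStrip hR (Metric.sphere_subset_closedBall hw))

lemma deriv (hg : IsStripFunction s' K g) (hs : s < s') :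
    IsStripFunction s (K / (s' - s)) (deriv g) where
  continuousOn := (hg.differentiableOn.deriv (isOpen_strip s')).continuousOn.mono
    (closedStrip_subset_strip hs)
  differentiableOn := (hg.differentiableOn.deriv (isOpen_strip s')).mono (strip_mono hs.le)
  periodic z hz := by
    rw [← deriv_comp_add_const]
    refine EventuallyEq.deriv_eq ?_
    filter_upwards [(isOpen_strip s').mem_nhds (closedStrip_subset_strip hs hz)] with w hw
    exact hg.periodic w (strip_subset_closedStrip _ hw)
  norm_le _ hz := hg.norm_deriv_le hs hz

lemma norm_sub_shift_le (hg : IsStripFunction s' K g) (hs : s < s') {z : ℂ}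
    (hz : z ∈ closedStrip s) (y : ℝ) : ‖g z - g (z - y)‖ ≤ K / (s' - s) * |y| := by
  have h := (convex_closedStrip s).norm_image_sub_le_of_norm_deriv_le
    (fun w hw => hg.differentiableOn.differentiableAt
      ((isOpen_strip s').mem_nhds (closedStrip_subset_strip hs hw)))
    (fun w hw => hg.norm_deriv_le hs hw) (sub_ofReal_mem_closedStrip hz y) hz
  rwa [sub_sub_cancel, Complex.norm_real, Real.norm_eq_abs] at h

end IsStripFunction

/-- The element of `E_s` given by a function on the strip, and `0` if there is none. -/
def ofFun (s : ℝ) (g : ℂ → ℂ) : StripSpace s :=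
  open Classical in
  if h : ∃ K, IsStripFunction s K g then
    ⟨BoundedContinuousFunction.ofNormedAddCommGroup (fun z : closedStrip s => g z)
      (continuousOn_iff_continuous_domRestrict.1 h.choose_spec.continuousOn) h.choose
      (fun z => h.choose_spec.norm_le z z.2), by
        refine ⟨fun z w hzw => ?_, ?_⟩
        · have := h.choose_spec.periodic z z.2
          rw [← hzw] at this
          exact this
        · refine h.choose_spec.differentiableOn.congr fun z hz => ?_
          rw [evalStrip_of_mem _ (strip_subset_closedStrip s hz)]
          rfl⟩
  else 0

section Val

variable {s : ℝ}

lemma val_of_mem (f : StripSpace s) {z : ℂ} (hz : z ∈ closedStrip s) :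
    val f z = (f : closedStrip s →ᵇ ℂ) ⟨z, hz⟩ := evalStrip_of_mem _ hz

lemma val_of_notMem (f : StripSpace s) {z : ℂ} (hz : z ∉ closedStrip s) : val f z = 0 := by
  simp [val, evalStrip, hz]

lemma IsStripFunction.val_ofFun {K : ℝ} {g : ℂ → ℂ} (h : IsStripFunction s K g) {z : ℂ}
    (hz : z ∈ closedStrip s) : val (ofFun s g) z = g z := by
  have h' : ∃ K, IsStripFunction s K g := ⟨K, h⟩
  rw [val_of_mem _ hz, ofFun, dif_pos h']
  rfl

lemma norm_val_le (f : StripSpace s) (z : ℂ) : ‖val f z‖ ≤ ‖f‖ := by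
  by_cases hz : z ∈ closedStrip s
  · rw [val_of_mem _ hz]
    exact (f : closedStrip s →ᵇ ℂ).norm_coe_le_norm _
  · rw [val_of_notMem _ hz, norm_zero]
    exact norm_nonneg f

lemma isStripFunction_val (f : StripSpace s) : IsStripFunction s ‖f‖ (val f) where
  continuousOn := by
    rw [continuousOn_iff_continuous_domRestrict]
    refine (f : closedStrip s →ᵇ ℂ).continuous.congr fun z => ?_
    rw [domRestrict_apply, val_of_mem _ z.2]
  differentiableOn := f.2.2
  periodic z hz := by
    rw [val_of_mem _ hz, val_of_mem _ (add_two_pi_mem_closedStrip hz)]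
    exact f.2.1 _ _ rfl
  norm_le z _ := norm_val_le f z

lemma continuousOn_val (f : StripSpace s) : ContinuousOn (val f) (closedStrip s) :=
  (isStripFunction_val f).continuousOn

lemma differentiableAt_val (f : StripSpace s) {z : ℂ} (hz : z ∈ strip s) :
    DifferentiableAt ℂ (val f) z :=
  (isStripFunction_val f).differentiableOn.differentiableAt ((isOpen_strip s).mem_nhds hz)

lemma val_ext {f g : StripSpace s} (h : ∀ z ∈ closedStrip s, val f z = val g z) : f = g := by
  apply Subtype.ext
  ext z
  simpa only [val_of_mem _ z.2] using h z z.2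

lemma val_ext_strip (hs : 0 < s) {f g : StripSpace s} (h : EqOn (val f) (val g) (strip s)) :
    f = g :=
  val_ext (h.of_subset_closure (continuousOn_val f) (continuousOn_val g)
    (strip_subset_closedStrip s) (closedStrip_subset_closure_strip hs))

lemma norm_le_of_val_le {f : StripSpace s} {K : ℝ} (hK : 0 ≤ K)
    (h : ∀ z ∈ closedStrip s, ‖val f z‖ ≤ K) : ‖f‖ ≤ K := by
  refine (BoundedContinuousFunction.norm_le hK).2 fun z => ?_
  have := h z z.2
  rwa [val_of_mem _ z.2] at this

lemma norm_le_of_val_le_strip (hs : 0 < s) {f : StripSpace s} {K : ℝ}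
    (h : ∀ z ∈ strip s, ‖val f z‖ ≤ K) : ‖f‖ ≤ K :=
  norm_le_of_val_le ((norm_nonneg _).trans (h 0 (by simpa [mem_strip] using hs))) fun z hz =>
    ContinuousWithinAt.closure_le (closedStrip_subset_closure_strip hs hz)
      ((continuousOn_val f).norm z hz |>.mono (strip_subset_closedStrip s))
      continuousWithinAt_const h

lemma IsStripFunction.norm_ofFun_le {K : ℝ} {g : ℂ → ℂ} (h : IsStripFunction s K g) (hK : 0 ≤ K) :
    ‖ofFun s g‖ ≤ K :=
  norm_le_of_val_le hK fun z hz => by rw [h.val_ofFun hz]; exact h.norm_le z hz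

lemma val_add (f g : StripSpace s) (z : ℂ) : val (f + g) z = val f z + val g z := by
  by_cases hz : z ∈ closedStrip s
  · simp [val_of_mem _ hz]
  · simp [val_of_notMem _ hz]

lemma val_sub (f g : StripSpace s) (z : ℂ) : val (f - g) z = val f z - val g z := by
  by_cases hz : z ∈ closedStrip s
  · simp [val_of_mem _ hz]
  · simp [val_of_notMem _ hz]

lemma val_smul (c : ℂ) (f : StripSpace s) (z : ℂ) : val (c • f) z = c * val f z := by
  by_cases hz : z ∈ closedStrip s
  · simp [val_of_mem _ hz]
  · simp [val_of_notMem _ hz]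

end Val

/-! ### Operators on the scale `E_s` -/

section Operators

variable {s s' : ℝ}

/-- Evaluation at a point, as a continuous linear functional on `E_s`; it is `0` off the strip. -/
def evalL (s : ℝ) (z : ℂ) : StripSpace s →L[ℂ] ℂ :=
  LinearMap.mkContinuous
    { toFun := fun f => val f z
      map_add' := fun f g => val_add f g z
      map_smul' := fun c f => val_smul c f z } 1
    fun f => (norm_val_le f z).trans_eq (one_mul _).symm

lemma evalL_apply (z : ℂ) (f : StripSpace s) : evalL s z f = val f z := rfl

/-- The continuous linear map into `E_s` given by a linear, uniformly bounded family of functions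
on the strip. -/
def ofFunL {E : Type*} [NormedAddCommGroup E] [NormedSpace ℂ E] (s K : ℝ) (T : E → ℂ → ℂ)
    (hK : 0 ≤ K) (hT : ∀ f, IsStripFunction s (K * ‖f‖) (T f))
    (hadd : ∀ f g, ∀ z ∈ closedStrip s, T (f + g) z = T f z + T g z)
    (hsmul : ∀ (c : ℂ) f, ∀ z ∈ closedStrip s, T (c • f) z = c * T f z) : E →L[ℂ] StripSpace s :=
  LinearMap.mkContinuous
    { toFun := fun f => ofFun s (T f)
      map_add' := fun f g => val_ext fun z hz => by
        rw [val_add, (hT _).val_ofFun hz, (hT _).val_ofFun hz, (hT _).val_ofFun hz, hadd f g z hz]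
      map_smul' := fun c f => val_ext fun z hz => by
        rw [RingHom.id_apply, val_smul, (hT _).val_ofFun hz, (hT _).val_ofFun hz, hsmul c f z hz] }
    K fun f => (hT f).norm_ofFun_le (by positivity)

lemma val_ofFunL {E : Type*} [NormedAddCommGroup E] [NormedSpace ℂ E] {K : ℝ} {T : E → ℂ → ℂ}
    {hK : 0 ≤ K} {hT : ∀ f, IsStripFunction s (K * ‖f‖) (T f)}
    {hadd : ∀ f g, ∀ z ∈ closedStrip s, T (f + g) z = T f z + T g z}
    {hsmul : ∀ (c : ℂ) f, ∀ z ∈ closedStrip s, T (c • f) z = c * T f z} (f : E) {z : ℂ}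
    (hz : z ∈ closedStrip s) : val (ofFunL s K T hK hT hadd hsmul f) z = T f z :=
  (hT f).val_ofFun hz

lemma norm_ofFunL_le {E : Type*} [NormedAddCommGroup E] [NormedSpace ℂ E] {K : ℝ}
    {T : E → ℂ → ℂ} {hK : 0 ≤ K} {hT : ∀ f, IsStripFunction s (K * ‖f‖) (T f)}
    {hadd : ∀ f g, ∀ z ∈ closedStrip s, T (f + g) z = T f z + T g z}
    {hsmul : ∀ (c : ℂ) f, ∀ z ∈ closedStrip s, T (c • f) z = c * T f z} (f : E) :
    ‖ofFunL s K T hK hT hadd hsmul f‖ ≤ K * ‖f‖ :=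
  (hT f).norm_ofFun_le (by positivity)

/-- The restriction `E_{s'} → E_s` for `s ≤ s'`. -/
def restrictL (h : s ≤ s') : StripSpace s' →L[ℂ] StripSpace s :=
  ofFunL s 1 val zero_le_one (fun f => by rw [one_mul]; exact (isStripFunction_val f).mono h)
    (fun f g z _ => val_add f g z) (fun c f z _ => val_smul c f z)

lemma val_restrictL (h : s ≤ s') (f : StripSpace s') {z : ℂ} (hz : z ∈ closedStrip s) :
    val (restrictL h f) z = val f z := val_ofFunL f hz

lemma norm_restrictL_le (h : s ≤ s') (f : StripSpace s') : ‖restrictL h f‖ ≤ ‖f‖ :=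
  (norm_ofFunL_le f).trans_eq (one_mul _)

/-- Complex differentiation `E_{s'} → E_s` for `s < s'`. -/
def derivL (h : s < s') : StripSpace s' →L[ℂ] StripSpace s :=
  ofFunL s (1 / (s' - s)) (fun f => deriv (val f)) (by have := sub_pos.2 h; positivity)
    (fun f => by
      rw [one_div_mul_eq_div]
      exact (isStripFunction_val f).deriv h)
    (fun f g z hz => by
      have hz' := closedStrip_subset_strip h hz
      rw [← deriv_fun_add (differentiableAt_val f hz') (differentiableAt_val g hz')]
      congr 1
      ext w
      exact val_add f g w)
    (fun c f z hz => by
      rw [← deriv_const_mul c (differentiableAt_val f (closedStrip_subset_strip h hz))]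
      congr 1
      ext w
      exact val_smul c f w)

lemma val_derivL (h : s < s') (f : StripSpace s') {z : ℂ} (hz : z ∈ closedStrip s) :
    val (derivL h f) z = deriv (val f) z := val_ofFunL f hz

/-- The translation `f ↦ f(· - y)` of `E_s` along the real direction. -/
def shiftL (s y : ℝ) : StripSpace s →L[ℂ] StripSpace s :=
  ofFunL s 1 (fun f z => val f (z - y)) zero_le_one
    (fun f => by rw [one_mul]; exact (isStripFunction_val f).shift y)
    (fun f g z _ => val_add f g (z - y)) (fun c f z _ => val_smul c f (z - y))

lemma val_shiftL (y : ℝ) (f : StripSpace s) {z : ℂ} (hz : z ∈ closedStrip s) :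
    val (shiftL s y f) z = val f (z - y) := val_ofFunL f hz

/-- Multiplication by an element of `E_s`. -/
def mulL (f : StripSpace s) : StripSpace s →L[ℂ] StripSpace s :=
  ofFunL s ‖f‖ (fun g z => val f z * val g z) (norm_nonneg f)
    (fun g => (isStripFunction_val f).mul (isStripFunction_val g) (norm_nonneg f))
    (fun g₁ g₂ z _ => by rw [val_add, mul_add]) (fun c g z _ => by rw [val_smul, mul_left_comm])

lemma val_mulL (f g : StripSpace s) {z : ℂ} (hz : z ∈ closedStrip s) :
    val (mulL f g) z = val f z * val g z := val_ofFunL g hz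

/-- The operator `X ↦ -(σ/ε) [X u - (X u)(· - σ ε)]` of the approximating equations. -/
def upwindL (σ ε : ℝ) (u : StripSpace s) : StripSpace s →L[ℂ] StripSpace s :=
  (-((σ : ℂ) / ε) • (ContinuousLinearMap.id ℂ _ - shiftL s (σ * ε))) ∘L mulL u

lemma val_upwindL (σ ε : ℝ) (u X : StripSpace s) {z : ℂ} (hz : z ∈ closedStrip s) :
    val (upwindL σ ε u X) z = -((σ : ℂ) / ε) *
      (val X z * val u z - val X (z - σ * ε) * val u (z - σ * ε)) := by
  have hz' : z - σ * ε ∈ closedStrip s := by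
    simpa using sub_ofReal_mem_closedStrip hz (σ * ε)
  have h : upwindL σ ε u X
      = -((σ : ℂ) / ε) • (mulL u X - shiftL s (σ * ε) (mulL u X)) := rfl
  rw [h, val_smul, val_sub, val_shiftL _ _ hz, val_mulL _ _ hz, Complex.ofReal_mul,
    val_mulL _ _ hz']
  ring

lemma norm_upwindL_apply_le (σ ε : ℝ) (u X : StripSpace s) :
    ‖upwindL σ ε u X‖ ≤ 2 * ‖(σ : ℂ) / ε‖ * ‖u‖ * ‖X‖ := by
  refine norm_le_of_val_le (by positivity) fun z hz => ?_
  have hprod (w : ℂ) : ‖val X w * val u w‖ ≤ ‖X‖ * ‖u‖ := by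
    rw [norm_mul]
    exact mul_le_mul (norm_val_le X w) (norm_val_le u w) (norm_nonneg _) (norm_nonneg _)
  rw [val_upwindL _ _ _ _ hz, norm_mul, norm_neg]
  calc ‖(σ : ℂ) / ε‖ * ‖_‖ ≤ ‖(σ : ℂ) / ε‖ * (‖X‖ * ‖u‖ + ‖X‖ * ‖u‖) := by
        gcongr
        exact (norm_sub_le _ _).trans (add_le_add (hprod _) (hprod _))
    _ = 2 * ‖(σ : ℂ) / ε‖ * ‖u‖ * ‖X‖ := by ring

lemma isBoundedBilinearMap_upwindL (σ ε : ℝ) :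
    IsBoundedBilinearMap ℂ fun p : StripSpace s × StripSpace s => upwindL σ ε p.1 p.2 where
  add_left u₁ u₂ X := val_ext fun z hz => by
    simp only [val_add, val_upwindL _ _ _ _ hz]
    ring
  smul_left c u X := val_ext fun z hz => by
    simp only [val_smul, val_upwindL _ _ _ _ hz]
    ring
  add_right u X₁ X₂ := map_add (upwindL σ ε u) X₁ X₂
  smul_right c u X := map_smul (upwindL σ ε u) c X
  bound := ⟨2 * ‖(σ : ℂ) / ε‖ + 1, by positivity, fun u X =>
    (norm_upwindL_apply_le σ ε u X).trans (by gcongr; linarith)⟩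

end Operators

/-! ### Bounded families of holomorphic functions -/

section BoundedFamilies

variable {ι E F : Type*} [NormedAddCommGroup E] [NormedSpace ℂ E] [NormedAddCommGroup F]
  [NormedSpace ℂ F] {l : Filter ι}

lemma norm_sub_le_of_bounded {f : E → F} {c z : E} {R K : ℝ}
    (hd : DifferentiableOn ℂ f (Metric.ball c R)) (hb : ∀ w ∈ Metric.ball c R, ‖f w‖ ≤ K)
    (hz : z ∈ Metric.ball c R) : ‖f z - f c‖ ≤ 2 * K / R * ‖z - c‖ := by
  have hc : c ∈ Metric.ball c R := Metric.mem_ball_self (Metric.pos_of_mem_ball hz)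
  have hmaps : MapsTo f (Metric.ball c R) (Metric.closedBall (f c) (2 * K)) := fun w hw => by
    rw [Metric.mem_closedBall, dist_eq_norm]
    linarith [norm_sub_le (f w) (f c), hb w hw, hb c hc]
  simpa only [dist_eq_norm] using Complex.dist_le_div_mul_dist_of_mapsTo_ball hd hmaps hz

theorem tendstoLocallyUniformlyOn_of_bounded [l.NeBot] {Ω : Set E} (hΩ : IsOpen Ω) {g : ι → E → F}
    {g₀ : E → F} {K : ℝ} (hd : ∀ᶠ i in l, DifferentiableOn ℂ (g i) Ω)
    (hb : ∀ᶠ i in l, ∀ z ∈ Ω, ‖g i z‖ ≤ K)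
    (hp : ∀ z ∈ Ω, Tendsto (fun i => g i z) l (𝓝 (g₀ z))) :
    TendstoLocallyUniformlyOn g g₀ l Ω := by
  rw [Metric.tendstoLocallyUniformlyOn_iff]
  intro e he p hpΩ
  obtain ⟨R, hR, hRΩ⟩ := Metric.isOpen_iff.1 hΩ p hpΩ
  have hlip : ∀ᶠ i in l, ∀ z ∈ Metric.ball p R, ‖g i z - g i p‖ ≤ 2 * K / R * ‖z - p‖ := by
    filter_upwards [hd, hb] with i hdi hbi z hz
    exact norm_sub_le_of_bounded (hdi.mono hRΩ) (fun w hw => hbi w (hRΩ hw)) hz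
  have hlip₀ : ∀ z ∈ Metric.ball p R, ‖g₀ z - g₀ p‖ ≤ 2 * K / R * ‖z - p‖ := fun z hz =>
    le_of_tendsto ((hp z (hRΩ hz)).sub (hp p hpΩ)).norm (hlip.mono fun i hi => hi z hz)
  have hsmall : ∀ᶠ z in 𝓝 p, 2 * K / R * ‖z - p‖ < e / 3 := by
    have hcont : Continuous fun z => 2 * K / R * ‖z - p‖ := by fun_prop
    exact hcont.tendsto p |>.eventually_lt_const (by simpa using he)
  have hpt : ∀ᶠ i in l, ‖g i p - g₀ p‖ < e / 3 :=
    (tendsto_iff_norm_sub_tendsto_zero.1 (hp p hpΩ)).eventually_lt_const (by positivity)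
  refine ⟨Metric.ball p R ∩ {z | 2 * K / R * ‖z - p‖ < e / 3},
    mem_nhdsWithin_of_mem_nhds (inter_mem (Metric.ball_mem_nhds p hR) hsmall), ?_⟩
  filter_upwards [hlip, hpt] with i hi hpi z ⟨hzR, hze⟩
  have hze' : 2 * K / R * ‖z - p‖ < e / 3 := hze
  calc dist (g₀ z) (g i z) = ‖(g₀ z - g₀ p) - (g i p - g₀ p) - (g i z - g i p)‖ := by
        rw [dist_eq_norm]
        congr 1
        abel
    _ ≤ ‖g₀ z - g₀ p‖ + ‖g i p - g₀ p‖ + ‖g i z - g i p‖ :=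
        (norm_sub_le _ _).trans (add_le_add_left (norm_sub_le _ _) _)
    _ < e := by linarith [hi z hzR, hlip₀ z hzR]

variable [l.NeBot] {Ω : Set ℂ} {g : ι → ℂ → ℂ} {g₀ : ℂ → ℂ} {K : ℝ}

theorem tendsto_deriv_of_bounded (hΩ : IsOpen Ω) (hd : ∀ᶠ i in l, DifferentiableOn ℂ (g i) Ω)
    (hb : ∀ᶠ i in l, ∀ z ∈ Ω, ‖g i z‖ ≤ K)
    (hp : ∀ z ∈ Ω, Tendsto (fun i => g i z) l (𝓝 (g₀ z))) {z : ℂ} (hz : z ∈ Ω) :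
    Tendsto (fun i => deriv (g i) z) l (𝓝 (deriv g₀ z)) :=
  ((tendstoLocallyUniformlyOn_of_bounded hΩ hd hb hp).deriv hd hΩ).tendsto_at hz

/-- The slopes `dslope (g i) z` again form a bounded family of holomorphic functions, hence they
converge locally uniformly and may be evaluated along `z - h i → z`. -/
theorem tendsto_differenceQuotient_of_bounded (hΩ : IsOpen Ω)
    (hd : ∀ᶠ i in l, DifferentiableOn ℂ (g i) Ω) (hb : ∀ᶠ i in l, ∀ z ∈ Ω, ‖g i z‖ ≤ K)
    (hp : ∀ z ∈ Ω, Tendsto (fun i => g i z) l (𝓝 (g₀ z))) {z : ℂ} (hz : z ∈ Ω)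
    {h : ι → ℂ} (hh : Tendsto h l (𝓝 0)) (hne : ∀ᶠ i in l, h i ≠ 0) :
    Tendsto (fun i => (h i)⁻¹ * (g i z - g i (z - h i))) l (𝓝 (deriv g₀ z)) := by
  obtain ⟨R, hR, hRΩ⟩ := Metric.isOpen_iff.1 hΩ z hz
  have hzR : z ∈ Metric.ball z R := Metric.mem_ball_self hR
  have hslope_diff : ∀ᶠ i in l, DifferentiableOn ℂ (dslope (g i) z) (Metric.ball z R) := by
    filter_upwards [hd] with i hdi
    exact (Complex.differentiableOn_dslope (Metric.ball_mem_nhds z hR)).2 (hdi.mono hRΩ)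
  have hslope_bdd : ∀ᶠ i in l, ∀ w ∈ Metric.ball z R, ‖dslope (g i) z w‖ ≤ 2 * K / R := by
    filter_upwards [hd, hb] with i hdi hbi w hw
    refine Complex.norm_dslope_le_div_of_mapsTo_ball (hdi.mono hRΩ) (fun w hw => ?_) hw
    rw [Metric.mem_closedBall, dist_eq_norm]
    linarith [norm_sub_le (g i w) (g i z), hbi w (hRΩ hw), hbi z hz]
  have hslope_lim : ∀ w ∈ Metric.ball z R,
      Tendsto (fun i => dslope (g i) z w) l (𝓝 (dslope g₀ z w)) := by
    intro w hw
    rcases eq_or_ne w z with rfl | hwz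
    · simpa only [dslope_same] using tendsto_deriv_of_bounded hΩ hd hb hp hz
    · simpa only [dslope_of_ne _ hwz, slope_def_module] using
        ((hp w (hRΩ hw)).sub (hp z hz)).const_smul _
  have hloc := tendstoLocallyUniformlyOn_of_bounded Metric.isOpen_ball hslope_diff hslope_bdd
    hslope_lim
  have hcont := ((hloc.differentiableOn hslope_diff Metric.isOpen_ball).continuousOn z hzR)
  have hpath : Tendsto (fun i => z - h i) l (𝓝[Metric.ball z R] z) := by
    rw [Metric.isOpen_ball.nhdsWithin_eq hzR]
    simpa using hh.const_sub z
  have hlim := hloc.tendsto_comp hcont hzR hpath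
  rw [dslope_same] at hlim
  refine hlim.congr' ?_
  filter_upwards [hne] with i hi
  rw [dslope_of_ne _ (by simpa using hi), slope_def_field, sub_sub_cancel_left, ← neg_sub,
    neg_div_neg_eq, div_eq_inv_mul]

end BoundedFamilies

/-! ### Holomorphic maps into Banach spaces -/

section Norming

variable {E Z : Type*} [NormedAddCommGroup E] [NormedSpace ℂ E] {e : Z → E →L[ℂ] ℂ} {U : Set ℂ}
  {K : ℝ} {G : ℂ → E}

lemma continuousOn_of_norming (he : ∀ (x : E) (K : ℝ), 0 ≤ K → (∀ i, ‖e i x‖ ≤ K) → ‖x‖ ≤ K)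
    (hU : IsOpen U) (hb : ∀ t ∈ U, ∀ i, ‖e i (G t)‖ ≤ K)
    (hd : ∀ i, DifferentiableOn ℂ (fun t => e i (G t)) U) : ContinuousOn G U := by
  intro t₀ ht₀
  obtain ⟨R, hR, hRU⟩ := Metric.isOpen_iff.1 hU t₀ ht₀
  have hlip : ∀ᶠ t in 𝓝 t₀, ‖G t - G t₀‖ ≤ 2 * |K| / R * ‖t - t₀‖ := by
    filter_upwards [Metric.ball_mem_nhds t₀ hR] with t ht
    refine he _ _ (by positivity) fun i => ?_
    rw [map_sub]
    exact norm_sub_le_of_bounded ((hd i).mono hRU)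
      (fun w hw => (hb w (hRU hw) i).trans (le_abs_self K)) ht
  have hlim : Tendsto (fun t => 2 * |K| / R * ‖t - t₀‖) (𝓝 t₀) (𝓝 0) := by
    have hcont : Continuous fun t => 2 * |K| / R * ‖t - t₀‖ := by fun_prop
    simpa using hcont.tendsto t₀
  exact ContinuousAt.continuousWithinAt
    (tendsto_iff_norm_sub_tendsto_zero.2 (squeeze_zero_norm' (by simpa using hlip) hlim))

lemma clm_circleIntegral_comm [CompleteSpace E] (L : E →L[ℂ] ℂ) {f : ℂ → E} {c : ℂ} {R : ℝ}
    (hf : CircleIntegrable f c R) :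
    L (∮ z in C(c, R), f z) = ∮ z in C(c, R), L (f z) := by
  rw [circleIntegral, ← ContinuousLinearMap.intervalIntegral_comp_comm L hf.out, circleIntegral]
  simp only [map_smul]

variable [CompleteSpace E]

lemma cauchyIntegral_eq_of_separating (he : ∀ x : E, (∀ i, e i x = 0) → x = 0) {c w : ℂ} {R : ℝ}
    (hG : ContinuousOn G (Metric.sphere c R))
    (hd : ∀ i, DiffContOnCl ℂ (fun t => e i (G t)) (Metric.ball c R)) (hw : w ∈ Metric.ball c R) :
    (2 * Real.pi * Complex.I : ℂ)⁻¹ • ∮ ζ in C(c, R), (ζ - w)⁻¹ • G ζ = G w := by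
  have hint : CircleIntegrable (fun ζ => (ζ - w)⁻¹ • G ζ) c R := by
    refine ContinuousOn.circleIntegrable (Metric.pos_of_mem_ball hw).le
      (ContinuousOn.smul (ContinuousOn.inv₀ (by fun_prop) fun ζ hζ h => ?_) hG)
    rw [sub_eq_zero.1 h] at hζ
    exact (Metric.mem_ball.1 hw).ne (Metric.mem_sphere.1 hζ)
  rw [← sub_eq_zero]
  refine he _ fun i => ?_
  rw [map_sub, map_smul, clm_circleIntegral_comm (e i) hint, sub_eq_zero,
    ← (hd i).two_pi_i_inv_smul_circleIntegral_sub_inv_smul hw]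
  simp only [map_smul]

/-- Cauchy's formula, which holds as it does after composition with each functional, represents the
map by a power series. -/
lemma differentiableOn_of_separating (he : ∀ x : E, (∀ i, e i x = 0) → x = 0) (hU : IsOpen U)
    (hG : ContinuousOn G U) (hd : ∀ i, DifferentiableOn ℂ (fun t => e i (G t)) U) :
    DifferentiableOn ℂ G U := by
  intro t₀ ht₀
  obtain ⟨R, hR, hRU⟩ := Metric.nhds_basis_closedBall.mem_iff.1 (hU.mem_nhds ht₀)
  lift R to NNReal using hR.le
  have hGs : ContinuousOn G (Metric.sphere t₀ R) :=
    hG.mono (Metric.sphere_subset_closedBall.trans hRU)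
  have hdR : ∀ i, DiffContOnCl ℂ (fun t => e i (G t)) (Metric.ball t₀ R) := fun i =>
    ((hd i).mono (Metric.closure_ball_subset_closedBall.trans hRU)).diffContOnCl
  have hseries := (hasFPowerSeriesOn_cauchy_integral (hGs.circleIntegrable R.coe_nonneg)
    (by exact_mod_cast hR)).differentiableOn
  rw [Metric.eball_coe] at hseries
  refine DifferentiableAt.differentiableWithinAt ?_
  refine (hseries.differentiableAt (Metric.ball_mem_nhds t₀ hR)).congr_of_eventuallyEq ?_
  filter_upwards [Metric.ball_mem_nhds t₀ hR] with w hw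
  exact (cauchyIntegral_eq_of_separating he hGs hdR hw).symm

theorem differentiableOn_of_norming
    (he : ∀ (x : E) (K : ℝ), 0 ≤ K → (∀ i, ‖e i x‖ ≤ K) → ‖x‖ ≤ K) (hU : IsOpen U)
    (hb : ∀ t ∈ U, ∀ i, ‖e i (G t)‖ ≤ K) (hd : ∀ i, DifferentiableOn ℂ (fun t => e i (G t)) U) :
    DifferentiableOn ℂ G U :=
  differentiableOn_of_separating
    (fun x hx => norm_le_zero_iff.1 (he x 0 le_rfl fun i => by rw [hx i, norm_zero])) hU
    (continuousOn_of_norming he hU hb hd) hd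

end Norming

section HolomorphicMaps

variable {s K : ℝ}

theorem differentiableOn_of_val {U : Set ℂ} (hU : IsOpen U) {G : ℂ → StripSpace s}
    (hb : ∀ t ∈ U, ∀ z ∈ closedStrip s, ‖val (G t) z‖ ≤ K)
    (hd : ∀ z ∈ closedStrip s, DifferentiableOn ℂ (fun t => val (G t) z) U) :
    DifferentiableOn ℂ G U :=
  differentiableOn_of_norming (e := fun z : closedStrip s => evalL s z)
    (fun _ _ hK h => norm_le_of_val_le hK fun z hz => h ⟨z, hz⟩) hU
    (fun t ht z => hb t ht z z.2) fun z => hd z z.2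

lemma differentiableOn_val_apply {U : Set ℂ} {G : ℂ → StripSpace s} (hG : DifferentiableOn ℂ G U)
    (z : ℂ) : DifferentiableOn ℂ (fun t => val (G t) z) U :=
  (evalL s z).differentiable.comp_differentiableOn hG

theorem differentiableOn_ofFun {U : Set ℂ} (hU : IsOpen U) {G : ℂ → ℂ → ℂ}
    (hspace : ∀ t ∈ U, IsStripFunction s K (fun z => G z t))
    (htime : ∀ z ∈ closedStrip s, DifferentiableOn ℂ (G z) U) :
    DifferentiableOn ℂ (fun t => ofFun s fun z => G z t) U := by
  refine differentiableOn_of_val (K := K) hU (fun t ht z hz => ?_) fun z hz => ?_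
  · rw [(hspace t ht).val_ofFun hz]
    exact (hspace t ht).norm_le z hz
  · exact (htime z hz).congr fun t ht => (hspace t ht).val_ofFun hz

/-- Evaluations at vectors of norm one are norming on the dual of `E_s`. -/
lemma differentiableOn_evalL : DifferentiableOn ℂ (evalL s) (strip s) :=
  differentiableOn_of_norming (K := 1)
    (e := fun f : {f : StripSpace s // ‖f‖ = 1} => ContinuousLinearMap.apply ℂ ℂ f.1)
    (fun (L : StripSpace s →L[ℂ] ℂ) _ hK h => L.opNorm_le_of_unit_norm hK fun f hf => h ⟨f, hf⟩)
    (isOpen_strip s) (fun z _ f => (norm_val_le f.1 z).trans_eq f.2)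
    fun f => (isStripFunction_val f.1).differentiableOn

theorem contDiffOn_val_joint {X : ℂ → StripSpace s} {U : Set ℂ} (hU : IsOpen U)
    (hX : DifferentiableOn ℂ X U) :
    ContDiffOn ℂ 1 (fun p : ℂ × ℂ => val (X p.2) p.1) (strip s ×ˢ U) := by
  have heval : ContDiffOn ℂ 1 (fun p : ℂ × ℂ => evalL s p.1) (strip s ×ˢ U) :=
    ContDiffOn.comp (g := evalL s) (differentiableOn_evalL.contDiffOn (isOpen_strip s))
      contDiffOn_fst fun _ hp => (mem_prod.1 hp).1
  have hX' : ContDiffOn ℂ 1 (fun p : ℂ × ℂ => X p.2) (strip s ×ˢ U) :=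
    (hX.contDiffOn hU).comp contDiffOn_snd fun _ hp => (mem_prod.1 hp).2
  exact heval.clm_apply hX'

end HolomorphicMaps

/-! ### Linear differential equations in a complex variable -/

section LinearODE

variable {E : Type*} [NormedAddCommGroup E] [NormedSpace ℂ E]

lemma ofReal_mul_mem_ball {T : ℝ} {t : ℂ} (ht : t ∈ Metric.ball 0 T) {τ : ℝ}
    (hτ : τ ∈ Icc (0 : ℝ) 1) : (τ : ℂ) * t ∈ Metric.ball 0 T := by
  rw [mem_ball_zero_iff] at ht ⊢
  rw [norm_mul, Complex.norm_real, Real.norm_of_nonneg hτ.1]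
  exact (mul_le_of_le_one_left (norm_nonneg t) hτ.2).trans_lt ht

lemma hasDerivAt_ray {g g' : ℂ → E} {T : ℝ} (hg : ∀ t ∈ Metric.ball 0 T, HasDerivAt g (g' t) t)
    {t : ℂ} (ht : t ∈ Metric.ball 0 T) {τ : ℝ} (hτ : τ ∈ Icc (0 : ℝ) 1) :
    HasDerivAt (fun τ : ℝ => g (τ * t)) (t • g' (τ * t)) τ := by
  have hray : HasDerivAt (fun τ : ℝ => (τ : ℂ) * t) t τ := by
    simpa using (Complex.ofRealCLM.hasDerivAt (x := τ)).mul_const t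
  exact (hg _ (ofReal_mul_mem_ball ht hτ)).scomp τ hray

lemma norm_sub_le_mul_pow_succ {g g' : ℂ → E} {T c : ℝ} {k : ℕ}
    (hg : ∀ t ∈ Metric.ball 0 T, HasDerivAt g (g' t) t)
    (hb : ∀ t ∈ Metric.ball 0 T, ‖g' t‖ ≤ c * (k + 1) * ‖t‖ ^ k) {t : ℂ}
    (ht : t ∈ Metric.ball 0 T) : ‖g t - g 0‖ ≤ c * ‖t‖ ^ (k + 1) := by
  have hray : ∀ τ ∈ Icc (0 : ℝ) 1,
      HasDerivAt (fun τ : ℝ => g (τ * t) - g 0) (t • g' (τ * t)) τ :=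
    fun τ hτ => (hasDerivAt_ray hg ht hτ).sub_const _
  have h := image_norm_le_of_norm_deriv_right_le_deriv_boundary' (a := 0) (b := 1)
    (B := fun τ => c * ‖t‖ ^ (k + 1) * τ ^ (k + 1))
    (fun τ hτ => (hray τ hτ).continuousAt.continuousWithinAt)
    (fun τ hτ => (hray τ (Ico_subset_Icc_self hτ)).hasDerivWithinAt) (by simp) (by fun_prop)
    (fun τ _ => ((hasDerivAt_pow (k + 1) τ).const_mul _).hasDerivWithinAt)
    (fun τ hτ => ?_) (right_mem_Icc.2 zero_le_one)
  · simpa using h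
  · have hτt := hb _ (ofReal_mul_mem_ball ht (Ico_subset_Icc_self hτ))
    rw [norm_mul, Complex.norm_real, Real.norm_of_nonneg hτ.1] at hτt
    rw [norm_smul]
    calc ‖t‖ * ‖g' (τ * t)‖ ≤ ‖t‖ * (c * (k + 1) * (τ * ‖t‖) ^ k) := by gcongr
      _ = c * ‖t‖ ^ (k + 1) * ((k + 1 : ℕ) * τ ^ (k + 1 - 1)) := by
        rw [Nat.add_sub_cancel]
        push_cast
        ring

lemma eq_zero_of_norm_deriv_le {g g' : ℂ → E} {T K : ℝ}
    (hg : ∀ t ∈ Metric.ball 0 T, HasDerivAt g (g' t) t) (h0 : g 0 = 0)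
    (hK : ∀ t ∈ Metric.ball 0 T, ‖g' t‖ ≤ K * ‖g t‖) {t : ℂ} (ht : t ∈ Metric.ball 0 T) :
    g t = 0 := by
  have h := eq_zero_of_abs_deriv_le_mul_abs_self_of_eq_zero_right (a := 0) (b := 1)
    (K := ‖t‖ * K) (f := fun τ : ℝ => g (τ * t)) (f' := fun τ : ℝ => t • g' (τ * t))
    (fun τ hτ => (hasDerivAt_ray hg ht hτ).continuousAt.continuousWithinAt)
    (fun τ hτ => (hasDerivAt_ray hg ht (Ico_subset_Icc_self hτ)).hasDerivWithinAt)
    (by simpa using h0)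
    (fun τ hτ => by
      rw [norm_smul, mul_assoc]
      exact mul_le_mul_of_nonneg_left (hK _ (ofReal_mul_mem_ball ht (Ico_subset_Icc_self hτ)))
        (norm_nonneg t)) 1 (right_mem_Icc.2 zero_le_one)
  simpa using h

/-- `D` is the sequence of Picard corrections for `x' = A x + f`, `x(0) = x₀` on `|t| < T`: the sum
of the first `k + 1` of them is the `k`-th Picard iterate. -/
structure IsPicardSequence (A : ℂ → E →L[ℂ] E) (f : ℂ → E) (x₀ : E) (T : ℝ) (D : ℕ → ℂ → E) :
    Prop where
  init : D 0 0 = x₀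
  hasDerivAt_zero : ∀ t ∈ Metric.ball (0 : ℂ) T, HasDerivAt (D 0) (f t) t
  init_succ : ∀ k, D (k + 1) 0 = 0
  hasDerivAt_succ : ∀ k, ∀ t ∈ Metric.ball (0 : ℂ) T, HasDerivAt (D (k + 1)) (A t (D k t)) t

theorem exists_isPicardSequence [CompleteSpace E] {A : ℂ → E →L[ℂ] E} {f : ℂ → E} {T : ℝ}
    (hA : ∀ X, DifferentiableOn ℂ X (Metric.ball 0 T) →
      DifferentiableOn ℂ (fun t => A t (X t)) (Metric.ball 0 T))
    (hf : DifferentiableOn ℂ f (Metric.ball 0 T))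
    (x₀ : E) : ∃ D, IsPicardSequence A f x₀ T D := by
  obtain ⟨g, hg0, hg⟩ := hf.isExactOn_ball.with_val_at 0 x₀
  have hgd : DifferentiableOn ℂ g (Metric.ball 0 T) :=
    fun t ht => (hg t ht).differentiableAt.differentiableWithinAt
  choose P hP0 hP using fun X : {X : ℂ → E // DifferentiableOn ℂ X (Metric.ball 0 T)} =>
    (hA X.1 X.2).isExactOn_ball.with_val_at 0 (0 : E)
  have hPd : ∀ X, DifferentiableOn ℂ (P X) (Metric.ball 0 T) :=
    fun X t ht => (hP X t ht).differentiableAt.differentiableWithinAt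
  let D : ℕ → {X : ℂ → E // DifferentiableOn ℂ X (Metric.ball 0 T)} :=
    fun k => Nat.rec ⟨g, hgd⟩ (fun _ X => ⟨P X, hPd X⟩) k
  exact ⟨fun k => (D k).1, hg0, hg, fun k => hP0 (D k), fun k => hP (D k)⟩

namespace IsPicardSequence

variable {A : ℂ → E →L[ℂ] E} {f : ℂ → E} {x₀ : E} {T K F : ℝ} {D : ℕ → ℂ → E}

lemma differentiableOn (hD : IsPicardSequence A f x₀ T D) (k : ℕ) :
    DifferentiableOn ℂ (D k) (Metric.ball 0 T) := by
  cases k with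
  | zero => exact fun t ht => (hD.hasDerivAt_zero t ht).differentiableAt.differentiableWithinAt
  | succ k => exact fun t ht => (hD.hasDerivAt_succ k t ht).differentiableAt.differentiableWithinAt

lemma norm_zero_le (hD : IsPicardSequence A f x₀ T D) (hF : ∀ t ∈ Metric.ball 0 T, ‖f t‖ ≤ F)
    {t : ℂ} (ht : t ∈ Metric.ball 0 T) : ‖D 0 t‖ ≤ ‖x₀‖ + F * T := by
  have hF0 : 0 ≤ F := (norm_nonneg _).trans (hF t ht)
  have h := norm_sub_le_mul_pow_succ (k := 0) hD.hasDerivAt_zero (by simpa using hF) ht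
  rw [hD.init, zero_add, pow_one] at h
  calc ‖D 0 t‖ ≤ ‖x₀‖ + ‖D 0 t - x₀‖ := norm_le_norm_add_norm_sub' _ _
    _ ≤ ‖x₀‖ + F * T := by
      have := (mem_ball_zero_iff.1 ht).le
      gcongr
      exact h.trans (by gcongr)

lemma norm_le (hD : IsPicardSequence A f x₀ T D) (hK : ∀ t ∈ Metric.ball 0 T, ‖A t‖ ≤ K)
    (hF : ∀ t ∈ Metric.ball 0 T, ‖f t‖ ≤ F) (k : ℕ) {t : ℂ} (ht : t ∈ Metric.ball 0 T) :
    ‖D k t‖ ≤ (‖x₀‖ + F * T) * ((K * ‖t‖) ^ k / k.factorial) := by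
  induction k generalizing t with
  | zero => simpa using hD.norm_zero_le hF ht
  | succ k ih =>
    have h := norm_sub_le_mul_pow_succ (k := k)
      (c := (‖x₀‖ + F * T) * K ^ (k + 1) / (k + 1).factorial) (hD.hasDerivAt_succ k)
      (fun τ hτ => ?_) ht
    · rw [hD.init_succ, sub_zero] at h
      exact h.trans_eq (by ring)
    · calc ‖A τ (D k τ)‖ ≤ K * ((‖x₀‖ + F * T) * ((K * ‖τ‖) ^ k / k.factorial)) :=
            (A τ).le_of_opNorm_le_of_le (hK τ hτ) (ih hτ)
        _ = (‖x₀‖ + F * T) * K ^ (k + 1) / (k + 1).factorial * (k + 1) * ‖τ‖ ^ k := by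
          rw [Nat.factorial_succ]
          push_cast
          field_simp
          ring

lemma exists_summable_bound (hD : IsPicardSequence A f x₀ T D)
    (hK : ∀ t ∈ Metric.ball 0 T, ‖A t‖ ≤ K) (hF : ∀ t ∈ Metric.ball 0 T, ‖f t‖ ≤ F) :
    ∃ b : ℕ → ℝ, Summable b ∧ ∀ k, ∀ t ∈ Metric.ball 0 T, ‖D k t‖ ≤ b k := by
  refine ⟨fun k => (‖x₀‖ + F * T) * ((K * T) ^ k / k.factorial),
    (Real.summable_pow_div_factorial (K * T)).mul_left _, fun k t ht => ?_⟩
  have hK0 : 0 ≤ K := (norm_nonneg _).trans (hK t ht)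
  have hF0 : 0 ≤ F := (norm_nonneg _).trans (hF t ht)
  have htT := (mem_ball_zero_iff.1 ht).le
  have hT := (norm_nonneg t).trans htT
  exact (hD.norm_le hK hF k ht).trans (by beta_reduce; gcongr)

lemma tsum_zero (hD : IsPicardSequence A f x₀ T D) : ∑' k, D k 0 = x₀ := by
  refine (tsum_eq_single 0 fun k hk => ?_).trans hD.init
  obtain ⟨j, rfl⟩ := Nat.exists_eq_succ_of_ne_zero hk
  exact hD.init_succ j

theorem hasDerivAt_tsum [CompleteSpace E] (hD : IsPicardSequence A f x₀ T D) {b : ℕ → ℝ}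
    (hb : Summable b) (hDb : ∀ k, ∀ t ∈ Metric.ball 0 T, ‖D k t‖ ≤ b k) {t : ℂ}
    (ht : t ∈ Metric.ball 0 T) :
    HasDerivAt (fun t => ∑' k, D k t) (A t (∑' k, D k t) + f t) t := by
  have hsum : Summable fun k => D k t := Summable.of_norm_bounded hb fun k => hDb k t ht
  have hdiff := Complex.differentiableOn_tsum_of_summable_norm hb hD.differentiableOn
    Metric.isOpen_ball hDb
  have hderiv : HasSum (fun k => deriv (D k) t) (A t (∑' k, D k t) + f t) := by
    rw [add_comm, ← hasSum_nat_add_iff' 1]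
    simp only [Finset.range_one, Finset.sum_singleton, (hD.hasDerivAt_zero t ht).deriv,
      add_sub_cancel_left, (hD.hasDerivAt_succ _ t ht).deriv]
    exact (A t).hasSum hsum.hasSum
  have h := (hdiff.differentiableAt (Metric.isOpen_ball.mem_nhds ht)).hasDerivAt
  rwa [(Complex.hasSum_deriv_of_summable_norm hb hD.differentiableOn Metric.isOpen_ball hDb
    ht).unique hderiv] at h

end IsPicardSequence

end LinearODE

/-! ### The approximating equation on the scale `E_s` -/

section Ovsyannikov

variable {s s' σ ε δ M : ℝ}

lemma norm_val_upwindL_le (hσ : |σ| = 1) (hε : 0 < ε) {u X : StripSpace s} {z : ℂ} {ρ K : ℝ}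
    (hρ : 0 < ρ) (hs : |z.im| + ρ ≤ s)
    (hK : ∀ w ∈ closedStrip (|z.im| + ρ), ‖val X w‖ * ‖val u w‖ ≤ K) :
    ‖val (upwindL σ ε u X) z‖ ≤ K / ρ := by
  have hz : z ∈ closedStrip |z.im| := mem_closedStrip.2 le_rfl
  have hprod : IsStripFunction (|z.im| + ρ) K fun w => val X w * val u w :=
    { ((isStripFunction_val X).mul (isStripFunction_val u) (norm_nonneg X)).mono hs with
      norm_le := fun w hw => (norm_mul _ _).trans_le (hK w hw) }
  have hdiff := hprod.norm_sub_shift_le (lt_add_of_pos_right _ hρ) hz (σ * ε)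
  rw [add_sub_cancel_left, abs_mul, hσ, one_mul, abs_of_pos hε, Complex.ofReal_mul] at hdiff
  rw [val_upwindL _ _ _ _ (mem_closedStrip.2 (by linarith)), norm_mul, norm_neg, norm_div,
    Complex.norm_real, Complex.norm_real, Real.norm_eq_abs, hσ, Real.norm_of_nonneg hε.le]
  calc 1 / ε * ‖_‖ ≤ 1 / ε * (K / ρ * ε) := by gcongr
    _ = K / ρ := by field_simp

lemma add_one_mul_div_pow_le (k : ℕ) :
    (k + 2 : ℝ) * ((k + 2) / (k + 1)) ^ k ≤ Real.exp 1 * (k + 1) := by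
  have hk : (0 : ℝ) < k + 1 := by positivity
  have hexp : ((k + 2 : ℝ) / (k + 1)) ^ (k + 1) ≤ Real.exp 1 := by
    have hbase : (1 / (k + 1) + 1 : ℝ) = (k + 2) / (k + 1) := by
      field_simp
      ring
    have h := pow_le_pow_left₀ (by positivity) (Real.add_one_le_exp (1 / (k + 1 : ℝ))) (k + 1)
    rwa [← Real.exp_nat_mul, Nat.cast_succ, mul_one_div_cancel hk.ne', hbase] at h
  calc (k + 2 : ℝ) * ((k + 2) / (k + 1)) ^ k = ((k + 2) / (k + 1)) ^ (k + 1) * (k + 1) := by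
        rw [pow_succ]
        field_simp
    _ ≤ Real.exp 1 * (k + 1) := by gcongr

/-- One step of Ovsyannikov's argument: losing the fraction `1 / (k + 2)` of the distance to the
boundary of the strip optimizes the power of that distance. -/
lemma norm_val_upwindL_le_of_le_pow (hσ : |σ| = 1) (hε : 0 < ε) {u X : StripSpace s} {k : ℕ}
    {G N : ℝ} (hu : ‖u‖ ≤ M)
    (hX : ∀ z ∈ strip s, ‖val X z‖ ≤ G * (N / (s - |z.im|)) ^ k) {z : ℂ} (hz : z ∈ strip s) :
    ‖val (upwindL σ ε u X) z‖
      ≤ G * (Real.exp 1 * M) * (k + 1) * N ^ k / (s - |z.im|) ^ (k + 1) := by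
  have hM : 0 ≤ M := (norm_nonneg u).trans hu
  have hG : 0 ≤ G * N ^ k := by
    have h0 := (norm_nonneg _).trans (hX z hz)
    rw [div_pow, ← mul_div_assoc] at h0
    have hd : 0 < (s - |z.im|) ^ k := pow_pos (sub_pos.2 (mem_strip.1 hz)) k
    simpa [div_mul_cancel₀ _ hd.ne'] using mul_nonneg h0 hd.le
  set d := s - |z.im|
  have hd0 : 0 < d := sub_pos.2 (mem_strip.1 hz)
  have hρ : 0 < d / (k + 2) := by positivity
  have hρd : d - d / (k + 2) = d * ((k + 1) / (k + 2)) := by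
    field_simp
    ring
  have hρd0 : 0 < d * ((k + 1 : ℝ) / (k + 2)) := by positivity
  have hXu : ∀ w ∈ closedStrip (|z.im| + d / (k + 2)),
      ‖val X w‖ * ‖val u w‖ ≤ G * N ^ k / (d * ((k + 1) / (k + 2))) ^ k * M := by
    intro w hw
    have hdw : d * ((k + 1) / (k + 2)) ≤ s - |w.im| := by
      rw [← hρd]
      linarith [mem_closedStrip.1 hw]
    have hXw := hX w (mem_strip.2 (by linarith))
    rw [div_pow, ← mul_div_assoc] at hXw
    exact mul_le_mul (hXw.trans (by gcongr)) ((norm_val_le u w).trans hu) (norm_nonneg _)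
      (by positivity)
  refine (norm_val_upwindL_le hσ hε hρ (by linarith) hXu).trans ?_
  calc G * N ^ k / (d * ((k + 1) / (k + 2))) ^ k * M / (d / (k + 2))
      = G * N ^ k * M / d ^ (k + 1) * ((k + 2) * ((k + 2) / (k + 1)) ^ k) := by
        rw [mul_pow, div_pow, div_pow, pow_succ]
        field_simp
    _ ≤ G * N ^ k * M / d ^ (k + 1) * (Real.exp 1 * (k + 1)) := by
        exact mul_le_mul_of_nonneg_left (add_one_mul_div_pow_le k) (by positivity)
    _ = G * (Real.exp 1 * M) * (k + 1) * N ^ k / d ^ (k + 1) := by ring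

lemma norm_val_picard_le (hσ : |σ| = 1) (hε : 0 < ε) {U f : ℂ → StripSpace s}
    {x₀ : StripSpace s} {D : ℕ → ℂ → StripSpace s} {G : ℝ}
    (hD : IsPicardSequence (fun t => upwindL σ ε (U t)) f x₀ δ D)
    (hU : ∀ t ∈ Metric.ball 0 δ, ‖U t‖ ≤ M) (hG : ∀ t ∈ Metric.ball 0 δ, ‖D 0 t‖ ≤ G) (k : ℕ)
    {t : ℂ} (ht : t ∈ Metric.ball 0 δ) {z : ℂ} (hz : z ∈ strip s) :
    ‖val (D k t) z‖ ≤ G * (Real.exp 1 * M * ‖t‖ / (s - |z.im|)) ^ k := by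
  induction k generalizing t z with
  | zero => simpa using (norm_val_le _ z).trans (hG t ht)
  | succ k ih =>
    have hderiv : ∀ τ ∈ Metric.ball (0 : ℂ) δ, HasDerivAt (fun τ => val (D (k + 1) τ) z)
        (val (upwindL σ ε (U τ) (D k τ)) z) τ := fun τ hτ =>
      (evalL s z).hasFDerivAt.comp_hasDerivAt τ (hD.hasDerivAt_succ k τ hτ)
    have h := norm_sub_le_mul_pow_succ (c := G * (Real.exp 1 * M / (s - |z.im|)) ^ (k + 1)) hderiv
      (fun τ hτ => (norm_val_upwindL_le_of_le_pow hσ hε (hU τ hτ) (fun w hw => ih hτ hw) hz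
        ).trans_eq (by generalize s - |z.im| = d; ring)) ht
    have h0 : val (D (k + 1) 0) z = 0 := by
      rw [hD.init_succ, ← evalL_apply, map_zero]
    rw [h0, sub_zero] at h
    exact h.trans_eq (by ring)

/-- The Picard series is dominated by a geometric series of ratio `1 / 2`, for times that do not
depend on `ε`. -/
lemma norm_val_tsum_picard_le (hσ : |σ| = 1) (hε : 0 < ε) (hs : s < s')
    (hδs : 2 * Real.exp 1 * M * δ ≤ s' - s) {U f : ℂ → StripSpace s'} {x₀ : StripSpace s'}
    {D : ℕ → ℂ → StripSpace s'} {G : ℝ}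
    (hD : IsPicardSequence (fun t => upwindL σ ε (U t)) f x₀ δ D)
    (hU : ∀ t ∈ Metric.ball 0 δ, ‖U t‖ ≤ M) (hG : ∀ t ∈ Metric.ball 0 δ, ‖D 0 t‖ ≤ G)
    {t : ℂ} (ht : t ∈ Metric.ball 0 δ) (hsum : Summable fun k => D k t) {z : ℂ}
    (hz : z ∈ closedStrip s) : ‖val (∑' k, D k t) z‖ ≤ 2 * G := by
  have hM : 0 ≤ M := (norm_nonneg _).trans (hU t ht)
  have hG0 : 0 ≤ G := (norm_nonneg _).trans (hG t ht)
  have hd : 0 < s' - |z.im| := by linarith [mem_closedStrip.1 hz]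
  have hratio : Real.exp 1 * M * ‖t‖ / (s' - |z.im|) ≤ 1 / 2 := by
    have htδ : Real.exp 1 * M * ‖t‖ ≤ Real.exp 1 * M * δ := by
      gcongr
      exact (mem_ball_zero_iff.1 ht).le
    rw [div_le_iff₀ hd]
    linarith [mem_closedStrip.1 hz]
  have hgeom : ∀ k, ‖val (D k t) z‖ ≤ (1 / 2) ^ k * G := fun k => by
    refine (norm_val_picard_le hσ hε hD hU hG k ht (closedStrip_subset_strip hs hz)).trans ?_
    rw [mul_comm]
    gcongr
  have hval : val (∑' k, D k t) z = ∑' k, val (D k t) z := (evalL s' z).map_tsum hsum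
  rw [hval]
  exact tsum_of_norm_bounded (hasSum_geometric_two.mul_right G) hgeom

lemma exists_summable_picard (hδ : 0 < δ) {U f : ℂ → StripSpace s} (x₀ : StripSpace s)
    {F : ℝ} (hUd : DifferentiableOn ℂ U (Metric.ball 0 δ))
    (hU : ∀ t ∈ Metric.ball 0 δ, ‖U t‖ ≤ M) (hfd : DifferentiableOn ℂ f (Metric.ball 0 δ))
    (hf : ∀ t ∈ Metric.ball 0 δ, ‖f t‖ ≤ F) :
    ∃ (D : ℕ → ℂ → StripSpace s) (b : ℕ → ℝ),
      IsPicardSequence (fun t => upwindL σ ε (U t)) f x₀ δ D ∧ Summable b ∧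
      ∀ k, ∀ t ∈ Metric.ball 0 δ, ‖D k t‖ ≤ b k := by
  have hM : 0 ≤ M := (norm_nonneg _).trans (hU 0 (Metric.mem_ball_self hδ))
  have hbil := isBoundedBilinearMap_upwindL (s := s) σ ε
  have hstep (X : ℂ → StripSpace s) (hX : DifferentiableOn ℂ X (Metric.ball 0 δ)) :
      DifferentiableOn ℂ (fun t => upwindL σ ε (U t) (X t)) (Metric.ball 0 δ) := by
    intro t ht
    exact (hbil.hasFDerivAt (U t, X t)).differentiableAt.comp_differentiableWithinAt t
      ((hUd t ht).prodMk (hX t ht))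
  have hnorm : ∀ t ∈ Metric.ball (0 : ℂ) δ, ‖upwindL σ ε (U t)‖ ≤ 2 * ‖(σ : ℂ) / ε‖ * M :=
    fun t ht => ContinuousLinearMap.opNorm_le_bound _ (by positivity) fun X =>
      (norm_upwindL_apply_le σ ε (U t) X).trans (by gcongr; exact hU t ht)
  obtain ⟨D, hD⟩ := exists_isPicardSequence hstep hfd x₀
  obtain ⟨b, hb, hDb⟩ := hD.exists_summable_bound hnorm hf
  exact ⟨D, b, hD, hb, hDb⟩

/-- The solution is the Picard series, which converges in `E_{s'}` for fixed `ε` and is bounded in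
the smaller strip uniformly in `ε`. -/
theorem exists_solvesStripODE (hσ : |σ| = 1) (hε : 0 < ε) (hδ : 0 < δ) (hs : s < s')
    (hδs : 2 * Real.exp 1 * M * δ ≤ s' - s) {U f : ℂ → StripSpace s'} {x₀ : StripSpace s'} {F : ℝ}
    (hUd : DifferentiableOn ℂ U (Metric.ball 0 δ)) (hU : ∀ t ∈ Metric.ball 0 δ, ‖U t‖ ≤ M)
    (hfd : DifferentiableOn ℂ f (Metric.ball 0 δ)) (hf : ∀ t ∈ Metric.ball 0 δ, ‖f t‖ ≤ F) :
    ∃ X : ℂ → StripSpace s,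
      SolvesStripODE σ ε δ (fun z t => val (U t) z) (fun z t => val (f t) z) (val x₀) X ∧
      ∀ t ∈ Metric.ball 0 δ, ‖X t‖ ≤ 2 * (‖x₀‖ + F * δ) := by
  have hf' : ∀ t ∈ Metric.ball 0 δ, ‖-f t‖ ≤ F := by simpa only [norm_neg] using hf
  obtain ⟨D, b, hD, hb, hDb⟩ := exists_summable_picard (σ := σ) (ε := ε) hδ x₀ hUd hU
    (f := fun t => -f t) hfd.fun_neg hf'
  have hsol : ∀ t ∈ Metric.ball (0 : ℂ) δ, HasDerivAt (fun t => restrictL hs.le (∑' k, D k t))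
      (restrictL hs.le (upwindL σ ε (U t) (∑' k, D k t) + -f t)) t := fun t ht =>
    (restrictL hs.le).hasFDerivAt.comp_hasDerivAt t (hD.hasDerivAt_tsum hb hDb ht)
  refine ⟨fun t => restrictL hs.le (∑' k, D k t),
    ⟨fun t ht => (hsol t ht).differentiableAt.differentiableWithinAt, fun z hz => ?_,
      fun t ht z hz => ?_⟩, fun t ht => ?_⟩
  · rw [val_restrictL _ _ hz, hD.tsum_zero]
  · have hz := strip_subset_closedStrip s hz
    have hzε : z - σ * ε ∈ closedStrip s := by
      simpa using sub_ofReal_mem_closedStrip hz (σ * ε)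
    rw [(hsol t ht).deriv, val_restrictL _ _ hz, val_restrictL _ _ hz, val_restrictL _ _ hzε,
      ← sub_eq_add_neg, val_sub, val_upwindL _ _ _ _ (closedStrip_mono hs.le hz)]
  · have hF : 0 ≤ F := (norm_nonneg _).trans (hf t ht)
    refine norm_le_of_val_le (by positivity) fun z hz => ?_
    rw [val_restrictL _ _ hz]
    exact norm_val_tsum_picard_le hσ hε hs hδs hD hU (fun τ hτ => hD.norm_zero_le hf' hτ) ht
      (Summable.of_norm_bounded hb fun k => hDb k t ht) hz

end Ovsyannikov

/-! ### Uniqueness, and restriction to the real axis -/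

section StripODE

variable {s s' σ ε δ M : ℝ} {u u' f f' : ℂ → ℂ → ℂ} {g₀ g₀' : ℂ → ℂ} {X Y : ℂ → StripSpace s}

namespace SolvesStripODE

lemma hasDerivAt (hX : SolvesStripODE σ ε δ u f g₀ X) {t : ℂ} (ht : t ∈ Metric.ball 0 δ) :
    HasDerivAt X (deriv X t) t :=
  (hX.holo.differentiableAt (Metric.isOpen_ball.mem_nhds ht)).hasDerivAt

lemma congr (hX : SolvesStripODE σ ε δ u f g₀ X)
    (hu : ∀ t ∈ Metric.ball (0 : ℂ) δ, ∀ z ∈ strip s, u z t = u' z t)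
    (hf : ∀ t ∈ Metric.ball (0 : ℂ) δ, ∀ z ∈ strip s, f z t = f' z t)
    (hg : ∀ z ∈ closedStrip s, g₀ z = g₀' z) : SolvesStripODE σ ε δ u' f' g₀' X where
  holo := hX.holo
  init z hz := (hX.init z hz).trans (hg z hz)
  ode t ht z hz := by
    have hzε : z - σ * ε ∈ strip s := by simpa using sub_ofReal_mem_strip hz (σ * ε)
    rw [hX.ode t ht z hz, hu t ht z hz, hu t ht _ hzε, hf t ht z hz]

lemma restrict {X : ℂ → StripSpace s'} (hX : SolvesStripODE σ ε δ u f g₀ X) (hs : s ≤ s') :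
    SolvesStripODE σ ε δ u f g₀ (fun t => restrictL hs (X t)) where
  holo := (restrictL hs).differentiable.comp_differentiableOn hX.holo
  init z hz := (val_restrictL hs _ hz).trans (hX.init z (closedStrip_mono hs hz))
  ode t ht z hz := by
    have hzε : z - σ * ε ∈ strip s := by simpa using sub_ofReal_mem_strip hz (σ * ε)
    have hderiv : HasDerivAt (fun t => restrictL hs (X t)) (restrictL hs (deriv X t)) t :=
      (restrictL hs).hasFDerivAt.comp_hasDerivAt t (hX.hasDerivAt ht)
    rw [hderiv.deriv, val_restrictL _ _ (strip_subset_closedStrip s hz),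
      val_restrictL _ _ (strip_subset_closedStrip s hz),
      val_restrictL _ _ (strip_subset_closedStrip s hzε), hX.ode t ht z (strip_mono hs hz)]

theorem eqOn (hs : 0 < s) (hu : ∀ t ∈ Metric.ball (0 : ℂ) δ, ∀ z ∈ strip s, ‖u z t‖ ≤ M)
    (hX : SolvesStripODE σ ε δ u f g₀ X) (hY : SolvesStripODE σ ε δ u f g₀ Y) :
    EqOn X Y (Metric.ball 0 δ) := by
  intro t ht
  have hinit : X 0 - Y 0 = 0 := val_ext fun z hz => by
    rw [val_sub, hX.init z hz, hY.init z hz, sub_self, ← evalL_apply, map_zero]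
  have hprod : ∀ τ ∈ Metric.ball (0 : ℂ) δ, ∀ z ∈ strip s,
      ‖val (X τ - Y τ) z * u z τ‖ ≤ ‖X τ - Y τ‖ * M := fun τ hτ z hz => by
    rw [norm_mul]
    exact mul_le_mul (norm_val_le _ z) (hu τ hτ z hz) (norm_nonneg _) (norm_nonneg _)
  refine sub_eq_zero.1 (eq_zero_of_norm_deriv_le (K := ‖(σ : ℂ) / ε‖ * (2 * M))
    (fun τ hτ => (hX.hasDerivAt hτ).sub (hY.hasDerivAt hτ)) hinit (fun τ hτ => ?_) ht)
  refine norm_le_of_val_le_strip hs fun z hz => ?_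
  have hzε : z - σ * ε ∈ strip s := by simpa using sub_ofReal_mem_strip hz (σ * ε)
  have hval : val (deriv X τ - deriv Y τ) z = -((σ : ℂ) / ε) * (val (X τ - Y τ) z * u z τ
      - val (X τ - Y τ) (z - σ * ε) * u (z - σ * ε) τ) := by
    simp only [val_sub, hX.ode τ hτ z hz, hY.ode τ hτ z hz]
    ring
  rw [hval, norm_mul, norm_neg, mul_assoc]
  gcongr
  calc ‖_ - _‖ ≤ ‖X τ - Y τ‖ * M + ‖X τ - Y τ‖ * M :=
        (norm_sub_le _ _).trans (add_le_add (hprod τ hτ z hz) (hprod τ hτ _ hzε))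
    _ = 2 * M * ‖(X - Y) τ‖ := by
      rw [Pi.sub_apply]
      ring

end SolvesStripODE

lemma restrictReal_apply (hs : 0 < s) (f : StripSpace s) (x : ℝ) :
    restrictReal hs f x = val f x := (val_of_mem f _).symm

/-- Restriction to the real axis as a continuous linear map. -/
def restrictRealL (hs : 0 < s) : StripSpace s →L[ℂ] (ℝ →ᵇ ℂ) :=
  LinearMap.mkContinuous
    { toFun := restrictReal hs
      map_add' := fun _ _ => rfl
      map_smul' := fun _ _ => rfl } 1 fun f => by
    refine (BoundedContinuousFunction.norm_le (mul_nonneg zero_le_one (norm_nonneg f))).2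
      fun x => ?_
    rw [one_mul]
    exact (congrArg norm (restrictReal_apply hs f x)).trans_le (norm_val_le f x)

lemma hasDerivAt_comp_ofReal {E : Type*} [NormedAddCommGroup E] [NormedSpace ℂ E] {g : ℂ → E}
    {d : E} {t : ℝ} (h : HasDerivAt g d (t : ℂ)) : HasDerivAt (fun τ : ℝ => g τ) d t := by
  simpa [Function.comp_def] using h.scomp t (Complex.ofRealCLM.hasDerivAt (x := t))

lemma ofReal_mem_ball {t : ℝ} (ht : t ∈ Ico 0 δ) : (t : ℂ) ∈ Metric.ball 0 δ := by
  rw [mem_ball_zero_iff, Complex.norm_real, Real.norm_of_nonneg ht.1]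
  exact ht.2

lemma upwind_eq_of_sign (hσ : σ = 1 ∨ σ = -1) {v : ℝ → ℝ} (hv : ∀ x, 0 ≤ σ * v x) (ε x : ℝ)
    (Y : ℝ → ℂ) :
    (1 / (ε : ℂ)) * (Y (x - ε) * ((max 0 (v (x - ε)) : ℝ) : ℂ) - Y x * ((|v x| : ℝ) : ℂ)
        + Y (x + ε) * ((max 0 (-v (x + ε)) : ℝ) : ℂ))
      = -((σ : ℂ) / ε) * (Y x * v x - Y (x - σ * ε) * v (x - σ * ε)) := by
  rcases hσ with rfl | rfl
  · have hpos : ∀ y, 0 ≤ v y := fun y => by simpa using hv y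
    rw [max_eq_right (hpos _), abs_of_nonneg (hpos _), max_eq_left (neg_nonpos.2 (hpos _)), one_mul]
    push_cast
    ring
  · have hneg : ∀ y, v y ≤ 0 := fun y => by simpa using hv y
    rw [max_eq_left (hneg _), abs_of_nonpos (hneg _), max_eq_right (neg_nonneg.2 (hneg _)),
      neg_one_mul, sub_neg_eq_add]
    push_cast
    ring

theorem SolvesStripODE.solvesUpwindODE (hs : 0 < s) (hσ : σ = 1 ∨ σ = -1)
    (hX : SolvesStripODE σ ε δ u f g₀ X) (hreal : ∀ x : ℝ, ∀ t ∈ Ico 0 δ, (u x (t : ℝ)).im = 0)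
    (hsign : ∀ x : ℝ, ∀ t ∈ Ico 0 δ, 0 ≤ σ * (u x (t : ℝ)).re) {k : ℝ → ℝ → ℂ}
    (hf : ∀ x : ℝ, ∀ t ∈ Ico 0 δ, f x (t : ℝ) = k x t) :
    SolvesUpwindODE ε δ (fun x t => (u x t).re) k (fun x => g₀ x)
      (fun t => restrictReal hs (X t)) where
  init x := by
    rw [restrictReal_apply, Complex.ofReal_zero, hX.init _ (ofReal_mem_closedStrip hs.le x)]
  ode t ht := by
    have hderiv : HasDerivAt (fun t => restrictRealL hs (X t)) (restrictRealL hs (deriv X t))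
        (t : ℂ) := (restrictRealL hs).hasFDerivAt.comp_hasDerivAt (t : ℂ)
      (hX.hasDerivAt (ofReal_mem_ball ht))
    have hure : ∀ y : ℝ, u y t = ((u y t).re : ℂ) := fun y =>
      Complex.ext (by simp) (by simp [hreal y t ht])
    refine ⟨restrictReal hs (deriv X t), (hasDerivAt_comp_ofReal hderiv).hasDerivWithinAt,
      fun x => ?_⟩
    rw [upwind_eq_of_sign hσ (fun y => hsign y t ht), ← hf x t ht, restrictReal_apply,
      hX.ode t (ofReal_mem_ball ht) x (ofReal_mem_strip hs x), ← hure, ← hure]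
    simp only [restrictReal_apply, Complex.ofReal_sub, Complex.ofReal_mul]

end StripODE

section UpwindODE

variable {ε M : ℝ}

lemma norm_upwind_le (hε : 0 < ε) {v : ℝ → ℝ} (hv : ∀ x, |v x| ≤ M) (F : ℝ →ᵇ ℂ) (x : ℝ) :
    ‖(1 / (ε : ℂ)) * (F (x - ε) * ((max 0 (v (x - ε)) : ℝ) : ℂ) - F x * ((|v x| : ℝ) : ℂ)
        + F (x + ε) * ((max 0 (-v (x + ε)) : ℝ) : ℂ))‖ ≤ 3 * M / ε * ‖F‖ := by
  have hM : 0 ≤ M := (abs_nonneg _).trans (hv 0)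
  have hprod : ∀ (y : ℝ) {c : ℝ}, |c| ≤ M → ‖F y * (c : ℂ)‖ ≤ ‖F‖ * M := fun y c hc => by
    rw [norm_mul, Complex.norm_real]
    exact mul_le_mul (F.norm_coe_le_norm y) hc (abs_nonneg c) (norm_nonneg _)
  have hmax : ∀ {c : ℝ}, |c| ≤ M → |max 0 c| ≤ M := fun {c} hc => by
    rw [abs_of_nonneg (le_max_left _ _)]
    exact max_le hM ((le_abs_self c).trans hc)
  have hleft := hprod (x - ε) (hmax (hv (x - ε)))
  have hmid := hprod x ((abs_abs (v x)).trans_le (hv x))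
  have hright := hprod (x + ε) (hmax ((abs_neg (v (x + ε))).trans_le (hv (x + ε))))
  rw [norm_mul, norm_div, norm_one, Complex.norm_real, Real.norm_of_nonneg hε.le]
  calc 1 / ε * ‖_‖ ≤ 1 / ε * (‖F‖ * M + ‖F‖ * M + ‖F‖ * M) := by
        gcongr
        exact (norm_add_le _ _).trans
          (add_le_add ((norm_sub_le _ _).trans (add_le_add hleft hmid)) hright)
    _ = 3 * M / ε * ‖F‖ := by ring

theorem SolvesUpwindODE.eqOn {T : ℝ} {v : ℝ → ℝ → ℝ} {k : ℝ → ℝ → ℂ} {g₀ : ℝ → ℂ}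
    {Y Z : ℝ → ℝ →ᵇ ℂ} (hε : 0 < ε) (hv : ∀ x, ∀ t ∈ Ico 0 T, |v x t| ≤ M)
    (hY : SolvesUpwindODE ε T v k g₀ Y) (hZ : SolvesUpwindODE ε T v k g₀ Z) :
    EqOn Y Z (Ico 0 T) := by
  intro t ht
  choose! DY hDY hDYeq using hY.ode
  choose! DZ hDZ hDZeq using hZ.ode
  have hsub : Icc 0 t ⊆ Ico 0 T := fun τ hτ => ⟨hτ.1, hτ.2.trans_lt ht.2⟩
  have hderiv : ∀ τ ∈ Ico 0 T, HasDerivWithinAt (fun τ => Y τ - Z τ) (DY τ - DZ τ) (Ici 0) τ :=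
    fun τ hτ => (hDY τ hτ).sub (hDZ τ hτ)
  refine sub_eq_zero.1 (eq_zero_of_abs_deriv_le_mul_abs_self_of_eq_zero_right (a := 0) (b := t)
    (f := fun τ => Y τ - Z τ) (f' := fun τ => DY τ - DZ τ) (K := 3 * M / ε)
    (fun τ hτ => ((hderiv τ (hsub hτ)).continuousWithinAt).mono Icc_subset_Ici_self)
    (fun τ hτ => (hderiv τ (hsub (Ico_subset_Icc_self hτ))).mono (Ici_subset_Ici.2 hτ.1))
    (sub_eq_zero.2 (BoundedContinuousFunction.ext fun x => (hY.init x).trans (hZ.init x).symm))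
    (fun τ hτ => ?_) t (right_mem_Icc.2 ht.1))
  have hτ := hsub (Ico_subset_Icc_self hτ)
  have hM : 0 ≤ M := (abs_nonneg _).trans (hv 0 τ hτ)
  refine (BoundedContinuousFunction.norm_le (by positivity)).2 fun x => ?_
  have h := norm_upwind_le hε (fun x => hv x τ hτ) (Y τ - Z τ) x
  simp only [BoundedContinuousFunction.sub_apply] at h ⊢
  rw [hDYeq τ hτ, hDZeq τ hτ]
  refine (congrArg norm ?_).trans_le h
  ring

end UpwindODE

/-! ### Mollification in the strip -/

section Mollify

variable {φ : ℝ → ℝ} {h s s' K : ℝ} {g : ℂ → ℂ}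

lemma mollifyC_eq (hh : 0 < h) (g : ℂ → ℂ) (z : ℂ) :
    mollifyC φ h g z = ∫ y : ℝ, g (z - (h * y : ℝ)) * (φ y : ℂ) := by
  have hscale := Measure.integral_comp_div (fun y : ℝ => g (z - (h * y : ℝ)) * (φ y : ℂ)) h
  simp only [mul_div_cancel₀ _ hh.ne', abs_of_pos hh] at hscale
  rw [← inv_smul_smul₀ hh.ne' (∫ y : ℝ, g (z - (h * y : ℝ)) * (φ y : ℂ)), ← hscale,
    ← integral_smul, mollifyC]
  congr 1 with y
  rw [Complex.real_smul]
  push_cast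
  ring

lemma aestronglyMeasurable_shift_mul (hφ : Integrable φ) (hg : ContinuousOn g (closedStrip s))
    {z : ℂ} (hz : z ∈ closedStrip s) :
    AEStronglyMeasurable fun y : ℝ => g (z - (h * y : ℝ)) * (φ y : ℂ) :=
  (hg.comp_continuous (by fun_prop)
    fun y => sub_ofReal_mem_closedStrip hz (h * y)).aestronglyMeasurable.mul
    hφ.ofReal.aestronglyMeasurable

lemma IsStripFunction.norm_shift_mul_le (hg : IsStripFunction s K g) {z : ℂ}
    (hz : z ∈ closedStrip s) (y : ℝ) : ‖g (z - (h * y : ℝ)) * (φ y : ℂ)‖ ≤ K * ‖φ y‖ := by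
  rw [norm_mul, Complex.norm_real]
  exact mul_le_mul_of_nonneg_right (hg.norm_le _ (sub_ofReal_mem_closedStrip hz _)) (norm_nonneg _)

lemma IsStripFunction.integrable_shift_mul (hφ : Integrable φ) (hg : IsStripFunction s K g)
    {z : ℂ} (hz : z ∈ closedStrip s) : Integrable fun y : ℝ => g (z - (h * y : ℝ)) * (φ y : ℂ) :=
  (hφ.norm.const_mul K).mono' (aestronglyMeasurable_shift_mul hφ hg.continuousOn hz)
    (Eventually.of_forall fun y => hg.norm_shift_mul_le hz y)

lemma differentiableAt_mollifyC (hφ : Integrable φ) (hh : 0 < h)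
    (hg : IsStripFunction s K g) {z₀ : ℂ} (hz₀ : z₀ ∈ strip s) :
    DifferentiableAt ℂ (mollifyC φ h g) z₀ := by
  obtain ⟨s', hzs', hs'⟩ := exists_between (mem_strip.1 hz₀)
  have hg' := hg.deriv hs'
  have hmem : strip s' ∈ 𝓝 z₀ := (isOpen_strip s').mem_nhds (mem_strip.2 hzs')
  have hclosed : ∀ z ∈ strip s', z ∈ closedStrip s := fun z hz =>
    closedStrip_mono hs'.le (strip_subset_closedStrip s' hz)
  have hderiv : ∀ y : ℝ, ∀ z ∈ strip s', HasDerivAt (fun z => g (z - (h * y : ℝ)) * (φ y : ℂ))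
      (deriv g (z - (h * y : ℝ)) * (φ y : ℂ)) z := fun y z hz =>
    ((hg.differentiableOn.differentiableAt ((isOpen_strip s).mem_nhds (sub_ofReal_mem_strip
      (strip_mono hs'.le hz) (h * y)))).hasDerivAt.comp_sub_const z _).mul_const _
  rw [show mollifyC φ h g = _ from funext (mollifyC_eq hh g)]
  exact (hasDerivAt_integral_of_dominated_loc_of_deriv_le
    (bound := fun y => K / (s - s') * ‖φ y‖) hmem
    (eventually_of_mem hmem fun z hz =>
      aestronglyMeasurable_shift_mul hφ hg.continuousOn (hclosed z hz))
    (hg.integrable_shift_mul hφ (strip_subset_closedStrip s hz₀))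
    (aestronglyMeasurable_shift_mul hφ hg'.continuousOn (mem_closedStrip.2 hzs'.le))
    (Eventually.of_forall fun y z hz => hg'.norm_shift_mul_le (strip_subset_closedStrip s' hz) y)
    (hφ.norm.const_mul _) (Eventually.of_forall hderiv)).2.differentiableAt

lemma isStripFunction_mollifyC (hφ : Integrable φ) (hh : 0 < h) (hg : IsStripFunction s K g) :
    IsStripFunction s ((∫ y, ‖φ y‖) * K) (mollifyC φ h g) where
  continuousOn := by
    rw [show mollifyC φ h g = _ from funext (mollifyC_eq hh g)]
    exact continuousOn_of_dominated (bound := fun y => K * ‖φ y‖)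
      (fun z hz => aestronglyMeasurable_shift_mul hφ hg.continuousOn hz)
      (fun z hz => Eventually.of_forall fun y => hg.norm_shift_mul_le hz y) (hφ.norm.const_mul K)
      (Eventually.of_forall fun y => (hg.shift (h * y)).continuousOn.mul continuousOn_const)
  differentiableOn z hz := (differentiableAt_mollifyC hφ hh hg hz).differentiableWithinAt
  periodic z hz := by
    simp only [mollifyC_eq hh, (hg.shift _).periodic z hz]
  norm_le z hz := by
    rw [mollifyC_eq hh, mul_comm, ← integral_const_mul]
    exact norm_integral_le_of_norm_le (hφ.norm.const_mul K)
      (Eventually.of_forall fun y => hg.norm_shift_mul_le hz y)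

/-- Mollification as a continuous linear map of `E_s`. -/
def mollifyL (s : ℝ) (hφ : Integrable φ) (hh : 0 < h) : StripSpace s →L[ℂ] StripSpace s :=
  ofFunL s (∫ y, ‖φ y‖) (fun f => mollifyC φ h (val f)) (integral_nonneg fun _ => norm_nonneg _)
    (fun f => isStripFunction_mollifyC hφ hh (isStripFunction_val f))
    (fun f g z hz => by
      rw [mollifyC_eq hh, mollifyC_eq hh, mollifyC_eq hh,
        ← integral_add ((isStripFunction_val f).integrable_shift_mul hφ hz)
          ((isStripFunction_val g).integrable_shift_mul hφ hz)]
      simp only [val_add, add_mul])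
    (fun c f z _ => by
      rw [mollifyC_eq hh, mollifyC_eq hh, ← integral_const_mul]
      simp only [val_smul, mul_assoc])

lemma val_mollifyL (hφ : Integrable φ) (hh : 0 < h) (f : StripSpace s) {z : ℂ}
    (hz : z ∈ closedStrip s) : val (mollifyL s hφ hh f) z = mollifyC φ h (val f) z :=
  val_ofFunL f hz

lemma integrable_min_mul_norm (hφ : Integrable φ) {A B : ℝ} (hA : 0 ≤ A) (hB : 0 ≤ B)
    (hh : 0 ≤ h) : Integrable fun y => min (A * (h * |y|)) B * ‖φ y‖ :=
  (hφ.norm.const_mul B).mono'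
    ((by fun_prop : Continuous fun y : ℝ => min (A * (h * |y|)) B).aestronglyMeasurable.mul
      hφ.norm.aestronglyMeasurable)
    (Eventually.of_forall fun y => by
      rw [norm_mul, norm_norm, Real.norm_of_nonneg (le_min (by positivity) hB)]
      exact mul_le_mul_of_nonneg_right (min_le_right _ _) (norm_nonneg _))

lemma tendsto_integral_min_mul_norm (hφ : Integrable φ) {A B : ℝ} (hA : 0 ≤ A) (hB : 0 ≤ B) :
    Tendsto (fun h : ℝ => ∫ y, min (A * (h * |y|)) B * ‖φ y‖) (𝓝[>] 0) (𝓝 0) := by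
  have hpos : ∀ᶠ h : ℝ in 𝓝[>] 0, 0 < h := self_mem_nhdsWithin
  have hlim := tendsto_integral_filter_of_dominated_convergence (μ := volume) (l := 𝓝[>] (0 : ℝ))
    (F := fun h y => min (A * (h * |y|)) B * ‖φ y‖) (f := fun _ => 0) (fun y => B * ‖φ y‖)
    (hpos.mono fun h hh => (integrable_min_mul_norm hφ hA hB hh.le).aestronglyMeasurable)
    (hpos.mono fun h hh => Eventually.of_forall fun y => by
      rw [norm_mul, norm_norm, Real.norm_of_nonneg (le_min (by positivity) hB)]
      exact mul_le_mul_of_nonneg_right (min_le_right _ _) (norm_nonneg _))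
    (hφ.norm.const_mul B)
    (Eventually.of_forall fun y => tendsto_nhdsWithin_of_tendsto_nhds
      (Continuous.tendsto' (by fun_prop) _ _ (by simp [hB])))
  simpa using hlim

lemma norm_mollifyC_sub_le (hφ1 : ∫ y, φ y = 1) (hh : 0 < h) (hg : IsStripFunction s' K g)
    (hs : s < s') {z : ℂ} (hz : z ∈ closedStrip s) (hK : 0 ≤ K) :
    ‖mollifyC φ h g z - g z‖ ≤ ∫ y, min (K / (s' - s) * (h * |y|)) (2 * K) * ‖φ y‖ := by
  have hφ : Integrable φ := integrable_of_integral_eq_one hφ1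
  have hz' := closedStrip_mono hs.le hz
  have hφℂ : Integrable fun y => (φ y : ℂ) := hφ.ofReal
  have hsub : mollifyC φ h g z - g z = ∫ y : ℝ, (g (z - (h * y : ℝ)) - g z) * (φ y : ℂ) := by
    simp only [sub_mul]
    rw [integral_sub (hg.integrable_shift_mul hφ hz') (hφℂ.const_mul (g z)),
      integral_const_mul, integral_complex_ofReal, hφ1, mollifyC_eq hh, Complex.ofReal_one, mul_one]
  rw [hsub]
  refine norm_integral_le_of_norm_le (integrable_min_mul_norm hφ
    (div_nonneg hK (sub_nonneg.2 hs.le)) (by positivity) hh.le) (Eventually.of_forall fun y => ?_)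
  rw [norm_mul, Complex.norm_real, norm_sub_rev]
  refine mul_le_mul_of_nonneg_right (le_min ?_ ?_) (norm_nonneg _)
  · simpa only [abs_mul, abs_of_pos hh] using hg.norm_sub_shift_le hs hz (h * y)
  · rw [two_mul]
    exact (norm_sub_le _ _).trans (add_le_add (hg.norm_le z hz')
      (hg.norm_le _ (sub_ofReal_mem_closedStrip hz' _)))

lemma tendsto_mollifyC {ι : Type*} {l : Filter ι} {h : ι → ℝ} {g : ι → ℂ → ℂ}
    (hφ1 : ∫ y, φ y = 1) (hs : s < s') (hh : Tendsto h l (𝓝[>] 0))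
    (hg : ∀ᶠ i in l, IsStripFunction s' K (g i)) (hK : 0 ≤ K) {z w : ℂ} (hz : z ∈ closedStrip s)
    (hw : Tendsto (fun i => g i z) l (𝓝 w)) :
    Tendsto (fun i => mollifyC φ (h i) (g i) z) l (𝓝 w) := by
  have hsub : Tendsto (fun i => mollifyC φ (h i) (g i) z - g i z) l (𝓝 0) := by
    refine squeeze_zero_norm' ?_ ((tendsto_integral_min_mul_norm
      (integrable_of_integral_eq_one hφ1) (div_nonneg hK (sub_nonneg.2 hs.le))
      (mul_nonneg zero_le_two hK)).comp hh)
    filter_upwards [hg, hh.eventually self_mem_nhdsWithin] with i hgi hhi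
    exact norm_mollifyC_sub_le hφ1 hhi hgi hs hz hK
  simpa using hsub.add hw

end Mollify

/-! ### The pressure term -/

section Pressure

variable {φ : ℝ → ℝ} {h s s' K : ℝ} {f g : ℂ → ℂ}

lemma isStripFunction_pressureGradC (n : ℕ) (hφ : Integrable φ) (hh : 0 < h) (hs : s < s')
    (hs' : 0 ≤ s') (hg : IsStripFunction s' K g) :
    IsStripFunction s (n * ((∫ y, ‖φ y‖) * K) ^ (n - 1) * ((∫ y, ‖φ y‖) * K / (s' - s)))
      (pressureGradC n φ h g) := by
  have hm := isStripFunction_mollifyC hφ hh hg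
  have hm0 := hm.nonneg hs'
  have hpow := (hm.mono hs.le).pow (n - 1) |>.const_mul (n : ℂ)
  rw [Complex.norm_natCast] at hpow
  exact hpow.mul (hm.deriv hs) (by positivity)

lemma differentiableOn_pressureGradC (n : ℕ) (hφ : Integrable φ) (hh : 0 < h) {U : Set ℂ}
    {X : ℂ → StripSpace s} (hX : DifferentiableOn ℂ X U) {z : ℂ} (hz : z ∈ strip s) :
    DifferentiableOn ℂ (fun t => pressureGradC n φ h (val (X t)) z) U := by
  obtain ⟨s', hzs', hs'⟩ := exists_between (mem_strip.1 hz)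
  have hm : DifferentiableOn ℂ (fun t => mollifyL s hφ hh (X t)) U :=
    (mollifyL s hφ hh).differentiable.comp_differentiableOn hX
  have hderiv := differentiableOn_val_apply
    ((derivL hs').differentiable.comp_differentiableOn hm) z
  refine (((differentiableOn_val_apply hm z).pow (n - 1)).const_mul (n : ℂ)).mul hderiv |>.congr
    fun t _ => ?_
  have heq : mollifyC φ h (val (X t)) =ᶠ[𝓝 z] val (mollifyL s hφ hh (X t)) :=
    eventually_of_mem ((isOpen_strip s).mem_nhds hz) fun w hw =>
      (val_mollifyL hφ hh (X t) (strip_subset_closedStrip s hw)).symm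
  rw [pressureGradC, heq.deriv_eq, heq.eq_of_nhds]
  exact congrArg _ (val_derivL hs' _ (mem_closedStrip.2 hzs'.le)).symm

lemma pressureGradC_congr (n : ℕ) (hfg : EqOn f g (closedStrip s)) {z : ℂ} (hz : z ∈ strip s) :
    pressureGradC n φ h f z = pressureGradC n φ h g z := by
  have hm : ∀ w ∈ strip s, mollifyC φ h f w = mollifyC φ h g w := fun w hw =>
    integral_congr_ae (Eventually.of_forall fun y => congrArg (· * _)
      (hfg (sub_ofReal_mem_closedStrip (strip_subset_closedStrip s hw) y)))
  have hev : mollifyC φ h f =ᶠ[𝓝 z] mollifyC φ h g :=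
    eventually_of_mem ((isOpen_strip s).mem_nhds hz) hm
  rw [pressureGradC, pressureGradC, hm z hz, hev.deriv_eq]

lemma pressureGradC_restrictL (n : ℕ) (hs : s ≤ s') (f : StripSpace s') {z : ℂ}
    (hz : z ∈ strip s) :
    pressureGradC n φ h (val (restrictL hs f)) z = pressureGradC n φ h (val f) z :=
  pressureGradC_congr n (fun _ hw => val_restrictL hs f hw) hz

lemma pressureGradC_ofReal (n : ℕ) (hs : 0 < s) (hφ : Integrable φ) (hh : 0 < h)
    (f : StripSpace s) (x : ℝ) :
    pressureGradC n φ h (val f) x = pressureGrad n φ h (restrictReal hs f) x := by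
  have hm : mollify φ h (restrictReal hs f) = fun x : ℝ => mollifyC φ h (val f) x := by
    ext x
    simp only [mollify, mollifyC, restrictReal_apply, Complex.ofReal_sub]
  have hd := (differentiableAt_mollifyC hφ hh (isStripFunction_val f)
    (ofReal_mem_strip hs x)).hasDerivAt
  rw [pressureGrad, pressureGradC, hm, (hasDerivAt_comp_ofReal hd).deriv]

theorem tendsto_pressureGradC {ι : Type*} {l : Filter ι} [l.NeBot] {h : ι → ℝ} {g : ι → ℂ → ℂ}
    (n : ℕ) (hφ1 : ∫ y, φ y = 1) (hh : Tendsto h l (𝓝[>] 0))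
    (hg : ∀ᶠ i in l, IsStripFunction s' K (g i)) (hK : 0 ≤ K)
    (hf : ∀ z ∈ strip s', Tendsto (fun i => g i z) l (𝓝 (f z))) {z : ℂ} (hz : z ∈ strip s') :
    Tendsto (fun i => pressureGradC n φ (h i) (g i) z) l (𝓝 (deriv (fun w => f w ^ n) z)) := by
  have hφ : Integrable φ := integrable_of_integral_eq_one hφ1
  have hstrip : ∀ᶠ i in l, IsStripFunction s' ((∫ y, ‖φ y‖) * K) (mollifyC φ (h i) (g i)) := by
    filter_upwards [hg, hh.eventually self_mem_nhdsWithin] with i hgi hhi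
      using isStripFunction_mollifyC hφ hhi hgi
  have hpt : ∀ w ∈ strip s', Tendsto (fun i => mollifyC φ (h i) (g i) w) l (𝓝 (f w)) :=
    fun w hw => tendsto_mollifyC hφ1 (mem_strip.1 hw) hh hg hK (mem_closedStrip.2 le_rfl) (hf w hw)
  have hdiff := hstrip.mono fun i hi => hi.differentiableOn
  have hbdd := hstrip.mono fun i hi w hw => hi.norm_le w (strip_subset_closedStrip s' hw)
  have hderiv := tendsto_deriv_of_bounded (isOpen_strip s') hdiff hbdd hpt hz
  have hd : DifferentiableAt ℂ f z :=
    ((tendstoLocallyUniformlyOn_of_bounded (isOpen_strip s') hdiff hbdd hpt).differentiableOn hdiff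
      (isOpen_strip s')).differentiableAt ((isOpen_strip s').mem_nhds hz)
  rw [deriv_fun_pow hd]
  exact (((hpt z hz).pow (n - 1)).const_mul (n : ℂ)).mul hderiv

end Pressure

/-! ### Classical solutions of the limit equation -/

section ClassicalSolutions

variable {δ s s' : ℝ} {u : ℝ → ℝ → ℝ} {f f₁ f₂ : ℝ → ℝ → ℂ} {g₀ g₁ g₂ : ℝ → ℂ} {Y Z : ℝ → ℝ → ℂ}

lemma nonneg_of_hasDerivAt_of_le_left {m : ℝ → ℝ} {m' t : ℝ} (hm : HasDerivAt m m' t) (ht : 0 < t)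
    (hle : ∀ τ ∈ Icc 0 t, m τ ≤ m t) : 0 ≤ m' := by
  refine ge_of_tendsto ((hasDerivWithinAt_iff_tendsto_slope' (s := Iio t) (lt_irrefl t)).1
    hm.hasDerivWithinAt) ?_
  filter_upwards [Ioo_mem_nhdsLT ht] with τ hτ
  rw [slope_def_field]
  exact div_nonneg_of_nonpos (sub_nonpos.2 (hle τ ⟨hτ.1.le, hτ.2.le⟩)) (sub_nonpos.2 hτ.2.le)

lemma exists_forall_le_of_periodic {q : ℝ → ℝ → ℝ} {c T : ℝ} (hc : 0 < c) (hT : 0 ≤ T)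
    (hper : ∀ t ∈ Icc 0 T, Function.Periodic (fun x => q x t) c)
    (hcont : ContinuousOn (Function.uncurry q) (univ ×ˢ Icc 0 T)) :
    ∃ x₀, ∃ t₀ ∈ Icc 0 T, ∀ x, ∀ t ∈ Icc 0 T, q x t ≤ q x₀ t₀ := by
  obtain ⟨⟨x₀, t₀⟩, ⟨-, ht₀⟩, hmax⟩ := (isCompact_Icc.prod isCompact_Icc).exists_isMaxOn
    ⟨(0, 0), left_mem_Icc.2 hc.le, left_mem_Icc.2 hT⟩
    (hcont.mono (prod_mono (subset_univ (Icc 0 c)) Subset.rfl))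
  refine ⟨x₀, t₀, ht₀, fun x t ht => ?_⟩
  obtain ⟨y, hy, hxy⟩ := (hper t ht).exists_mem_Ico₀ hc x
  exact hxy.trans_le (hmax (mk_mem_prod (Ico_subset_Icc_self hy) ht))

/-- Weighting by `exp (-(K + 1) t)` turns growth at rate at most `K` at the spatial maxima into
strict decay. -/
theorem nonpos_of_hasDerivAt_le_at_max {q : ℝ → ℝ → ℝ} {c T K : ℝ} (hc : 0 < c)
    (hper : ∀ t ∈ Icc 0 T, Function.Periodic (fun x => q x t) c)
    (hcont : ContinuousOn (Function.uncurry q) (univ ×ˢ Icc 0 T)) (hinit : ∀ x, q x 0 ≤ 0)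
    (hderiv : ∀ x, ∀ t ∈ Ioc 0 T, (∀ y, q y t ≤ q x t) →
      ∃ q' ≤ K * q x t, HasDerivAt (q x) q' t) {t : ℝ} (ht : t ∈ Icc 0 T) (x : ℝ) : q x t ≤ 0 := by
  set e : ℝ → ℝ := fun t => Real.exp (-(K + 1) * t)
  have hepos : ∀ t, 0 < e t := fun t => Real.exp_pos _
  obtain ⟨x₀, t₀, ht₀, hmax⟩ := exists_forall_le_of_periodic (q := fun x t => q x t * e t) hc
    (ht.1.trans ht.2) (fun t ht x => congrArg (· * e t) (hper t ht x))
    (hcont.mul (Continuous.continuousOn (by fun_prop)))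
  suffices hmax_nonpos : q x₀ t₀ ≤ 0 from
    nonpos_of_mul_nonpos_left ((hmax x t ht).trans
      (mul_nonpos_of_nonpos_of_nonneg hmax_nonpos (hepos t₀).le)) (hepos t)
  by_contra! hpos
  have ht₀pos : 0 < t₀ := ht₀.1.lt_of_ne fun h => hpos.not_ge (h ▸ hinit x₀)
  obtain ⟨q', hq', hq⟩ := hderiv x₀ t₀ ⟨ht₀pos, ht₀.2⟩
    fun y => le_of_mul_le_mul_right (hmax y t₀ ht₀) (hepos t₀)
  have hed : HasDerivAt e (e t₀ * -(K + 1)) t₀ := by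
    simpa only [id, mul_one] using ((hasDerivAt_id t₀).const_mul (-(K + 1))).exp
  have hnonneg := nonneg_of_hasDerivAt_of_le_left (hq.mul hed) ht₀pos
    fun τ hτ => hmax x₀ τ ⟨hτ.1, hτ.2.trans ht₀.2⟩
  nlinarith [mul_pos hpos (hepos t₀), mul_le_mul_of_nonneg_right hq' (hepos t₀).le]

namespace IsClassicalSolution

lemma sub (hY : IsClassicalSolution δ u f₁ g₁ Y) (hZ : IsClassicalSolution δ u f₂ g₂ Z) :
    IsClassicalSolution δ u (fun x t => f₁ x t - f₂ x t) (fun x => g₁ x - g₂ x)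
      (fun x t => Y x t - Z x t) where
  periodic t ht := (hY.periodic t ht).sub (hZ.periodic t ht)
  contDiffOn := hY.contDiffOn.sub hZ.contDiffOn
  init x := congrArg₂ _ (hY.init x) (hZ.init x)
  pde x t ht := by
    obtain ⟨dY, hdY, hdYt⟩ := hY.pde x t ht
    obtain ⟨dZ, hdZ, hdZt⟩ := hZ.pde x t ht
    refine ⟨dY - dZ, ?_, (hdYt.sub hdZt).congr_deriv (by ring)⟩
    simpa only [sub_mul] using hdY.fun_sub hdZ

lemma differentiableAt (hY : IsClassicalSolution δ u f g₀ Y) {t : ℝ} (ht : t ∈ Ico 0 δ) (x : ℝ) :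
    DifferentiableAt ℝ (fun ξ => Y ξ t) x := by
  have hjoint := hY.contDiffOn.differentiableOn one_ne_zero (x, t) (mk_mem_prod (mem_univ x) ht)
  have hline : DifferentiableWithinAt ℝ (fun ξ : ℝ => (ξ, t)) univ x := by fun_prop
  exact differentiableWithinAt_univ.1 (DifferentiableWithinAt.comp (g := Function.uncurry Y) x
    hjoint hline fun ξ _ => mk_mem_prod (mem_univ ξ) ht)

/-- At a spatial maximum of `‖Y‖²` the transport term `u ∂ₓY` is orthogonal to `Y`. -/
lemma hasDerivAt_normSq_of_isMax (hY : IsClassicalSolution δ u (fun _ _ => 0) g₀ Y) {x t : ℝ}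
    (ht : t ∈ Ioo 0 δ) (hu : DifferentiableAt ℝ (fun ξ => u ξ t) x)
    (hmax : ∀ y, ‖Y y t‖ ^ 2 ≤ ‖Y x t‖ ^ 2) :
    HasDerivAt (fun τ => ‖Y x τ‖ ^ 2) (-2 * deriv (fun ξ => u ξ t) x * ‖Y x t‖ ^ 2) t := by
  set u' := deriv (fun ξ => u ξ t) x
  set Y' := deriv (fun ξ => Y ξ t) x
  have hYx : HasDerivAt (fun ξ => Y ξ t) Y' x :=
    (hY.differentiableAt (Ioo_subset_Ico_self ht) x).hasDerivAt
  obtain ⟨d, hd, hdt⟩ := hY.pde x t (Ioo_subset_Ico_self ht)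
  have hd_eq : d = Y' * u x t + Y x t * u' := hd.unique (hYx.mul hu.hasDerivAt.ofReal_comp)
  have horth : inner ℝ (Y x t) Y' = 0 := by
    have hcrit := IsLocalMax.hasDerivAt_eq_zero (Eventually.of_forall hmax) hYx.norm_sq
    linarith
  refine (hdt.hasDerivAt (Ici_mem_nhds ht.1)).norm_sq.congr_deriv ?_
  rw [hd_eq, sub_zero, inner_neg_right, inner_add_right, mul_comm Y', mul_comm (Y x t),
    ← Complex.real_smul, ← Complex.real_smul, inner_smul_right, inner_smul_right, horth,
    real_inner_self_eq_norm_sq]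
  ring

theorem eq_zero {K : ℝ} (hu : ∀ t ∈ Ico 0 δ, ∀ x, DifferentiableAt ℝ (fun ξ => u ξ t) x)
    (hK : ∀ t ∈ Ico 0 δ, ∀ x, |deriv (fun ξ => u ξ t) x| ≤ K)
    (hY : IsClassicalSolution δ u (fun _ _ => 0) (fun _ => 0) Y) {t : ℝ} (ht : t ∈ Ico 0 δ)
    (x : ℝ) : Y x t = 0 := by
  have hsub : Icc 0 t ⊆ Ico 0 δ := fun τ hτ => ⟨hτ.1, hτ.2.trans_lt ht.2⟩
  have hnonpos := nonpos_of_hasDerivAt_le_at_max (q := fun x t => ‖Y x t‖ ^ 2) (K := 2 * K)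
    Real.two_pi_pos (fun τ hτ y => congrArg (‖·‖ ^ 2) (hY.periodic τ (hsub hτ) y))
    ((hY.contDiffOn.continuousOn.mono (prod_mono Subset.rfl hsub)).norm.fun_pow 2)
    (fun y => by simp [hY.init])
    (fun y τ hτ hmax => ?_) (right_mem_Icc.2 ht.1) x
  · simpa using hnonpos.antisymm (sq_nonneg _)
  · have hτδ : τ ∈ Ico 0 δ := hsub (Ioc_subset_Icc_self hτ)
    refine ⟨_, ?_, hY.hasDerivAt_normSq_of_isMax ⟨hτ.1, hτδ.2⟩ (hu τ hτδ y) hmax⟩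
    refine mul_le_mul_of_nonneg_right ?_ (sq_nonneg _)
    linarith [neg_le_of_abs_le (hK τ hτδ y)]

theorem eq {K : ℝ} (hu : ∀ t ∈ Ico 0 δ, ∀ x, DifferentiableAt ℝ (fun ξ => u ξ t) x)
    (hK : ∀ t ∈ Ico 0 δ, ∀ x, |deriv (fun ξ => u ξ t) x| ≤ K)
    (hY : IsClassicalSolution δ u f g₀ Y) (hZ : IsClassicalSolution δ u f g₀ Z) (x : ℝ) {t : ℝ}
    (ht : t ∈ Ico 0 δ) : Y x t = Z x t := by
  have hYZ := hY.sub hZ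
  simp only [sub_self] at hYZ
  exact sub_eq_zero.1 (hYZ.eq_zero hu hK ht x)

end IsClassicalSolution

theorem isClassicalSolution_val (hs : 0 < s) {X U : ℂ → StripSpace s} {k : ℂ → ℂ → ℂ}
    (hX : DifferentiableOn ℂ X (Metric.ball 0 δ))
    (hU : ∀ x : ℝ, ∀ t ∈ Ico 0 δ, val (U (t : ℝ)) x = u x t)
    (hinit : ∀ x : ℝ, val (X 0) x = g₀ x)
    (hode : ∀ t ∈ Metric.ball (0 : ℂ) δ, ∀ z ∈ strip s,
      val (deriv X t) z = -deriv (fun w => val (X t) w * val (U t) w) z - k z t)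
    (hk : ∀ x : ℝ, ∀ t ∈ Ico 0 δ, k x (t : ℝ) = f x t) :
    IsClassicalSolution δ u f g₀ (fun x t => val (X t) x) where
  periodic t _ x := by
    simpa using (isStripFunction_val (X t)).periodic x (ofReal_mem_closedStrip hs.le x)
  contDiffOn := by
    have hjoint := (contDiffOn_val_joint Metric.isOpen_ball hX).restrict_scalars ℝ
    have hreal : ContDiff ℝ 1 fun q : ℝ × ℝ => ((q.1 : ℂ), (q.2 : ℂ)) :=
      (Complex.ofRealCLM.contDiff.comp contDiff_fst).prodMk
        (Complex.ofRealCLM.contDiff.comp contDiff_snd)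
    exact hjoint.comp hreal.contDiffOn
      fun q hq => ⟨ofReal_mem_strip hs q.1, ofReal_mem_ball hq.2⟩
  init x := by rw [Complex.ofReal_zero, hinit]
  pde x t ht := by
    have hx := ofReal_mem_strip hs x
    have hprod := hasDerivAt_comp_ofReal
      ((differentiableAt_val (X t) hx).fun_mul (differentiableAt_val (U t) hx)).hasDerivAt
    have htime := hasDerivAt_comp_ofReal ((evalL s x).hasFDerivAt.comp_hasDerivAt (t : ℂ)
      (hX.differentiableAt (Metric.isOpen_ball.mem_nhds (ofReal_mem_ball ht))).hasDerivAt)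
    rw [evalL_apply, hode t (ofReal_mem_ball ht) x hx, hk x t ht] at htime
    refine ⟨_, ?_, htime.hasDerivWithinAt⟩
    simpa only [hU _ t ht] using hprod

theorem IsClassicalSolution.eq_of_val (hs : 0 < s) {U : ℂ → StripSpace s} {K : ℝ}
    (hUK : ∀ t ∈ Metric.ball 0 δ, ‖U t‖ ≤ K)
    (hU : ∀ x : ℝ, ∀ t ∈ Ico 0 δ, val (U (t : ℝ)) x = u x t)
    (hY : IsClassicalSolution δ u f g₀ Y) (hZ : IsClassicalSolution δ u f g₀ Z) (x : ℝ) {t : ℝ}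
    (ht : t ∈ Ico 0 δ) : Y x t = Z x t := by
  have hderiv : ∀ t ∈ Ico 0 δ, ∀ x : ℝ,
      HasDerivAt (fun ξ => u ξ t) (deriv (val (U (t : ℝ))) x).re x := fun t ht x => by
    have h := (differentiableAt_val (U t) (ofReal_mem_strip hs x)).hasDerivAt.real_of_complex
    simpa only [hU _ t ht, Complex.ofReal_re] using h
  refine hY.eq (K := K / (s - 0)) (fun t ht x => (hderiv t ht x).differentiableAt)
    (fun t ht x => ?_) hZ x ht
  rw [(hderiv t ht x).deriv]
  exact (Complex.abs_re_le_norm _).trans (((isStripFunction_val (U t)).norm_deriv_le hs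
    (ofReal_mem_closedStrip le_rfl x)).trans
      (div_le_div_of_nonneg_right (hUK t (ofReal_mem_ball ht)) (by simpa using hs.le)))

end ClassicalSolutions

/-! ### Bounded families and their limits -/

section Families

variable {ι : Type*} {l : Filter ι} {s s' δ K : ℝ} {X : ι → ℂ → StripSpace s'}
  {Y Z : ℂ → StripSpace s}

/-- The maps `X i : {|t| < δ} → E_s` are eventually holomorphic and bounded by `K` along `l`. -/
structure IsBoundedFamily (l : Filter ι) (δ K : ℝ) (X : ι → ℂ → StripSpace s) : Prop where
  holo : ∀ᶠ i in l, DifferentiableOn ℂ (X i) (Metric.ball 0 δ)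
  norm_le : ∀ᶠ i in l, ∀ t ∈ Metric.ball 0 δ, ‖X i t‖ ≤ K

/-- `Y : {|t| < δ} → E_s` is the holomorphic pointwise limit along `l` of the maps `X i` into
`E_{s'}`, where typically `s < s'`. -/
structure IsStripLimit (l : Filter ι) (δ : ℝ) (X : ι → ℂ → StripSpace s') (Y : ℂ → StripSpace s) :
    Prop where
  holo : DifferentiableOn ℂ Y (Metric.ball 0 δ)
  tendsto : ∀ t ∈ Metric.ball 0 δ, ∀ z ∈ closedStrip s,
    Tendsto (fun i => val (X i t) z) l (𝓝 (val (Y t) z))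

lemma IsBoundedFamily.mono {l' : Filter ι} (hX : IsBoundedFamily l δ K X) (h : l' ≤ l) :
    IsBoundedFamily l' δ K X :=
  ⟨hX.holo.filter_mono h, hX.norm_le.filter_mono h⟩

lemma IsStripLimit.mono {l' : Filter ι} (hY : IsStripLimit l δ X Y) (h : l' ≤ l) :
    IsStripLimit l' δ X Y :=
  ⟨hY.holo, fun t ht z hz => (hY.tendsto t ht z hz).mono_left h⟩

lemma IsBoundedFamily.isStripFunction_val (hX : IsBoundedFamily l δ K X) {t : ℂ}
    (ht : t ∈ Metric.ball 0 δ) : ∀ᶠ i in l, IsStripFunction s' K (val (X i t)) :=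
  hX.norm_le.mono fun i hi => (WeakAsymptotic.isStripFunction_val (X i t)).mono_bound (hi t ht)

lemma IsStripLimit.norm_le [l.NeBot] (hX : IsBoundedFamily l δ K X) (hY : IsStripLimit l δ X Y)
    {t : ℂ} (ht : t ∈ Metric.ball 0 δ) : ‖Y t‖ ≤ K := by
  obtain ⟨i, hi⟩ := hX.norm_le.exists
  refine norm_le_of_val_le ((norm_nonneg _).trans (hi t ht)) fun z hz => ?_
  exact le_of_tendsto (hY.tendsto t ht z hz).norm
    (hX.norm_le.mono fun i hi => (norm_val_le _ _).trans (hi t ht))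

lemma isStripFunction_of_tendsto [l.NeBot] (hs : s < s') {g : ι → ℂ → ℂ} {g₀ : ℂ → ℂ}
    (hg : ∀ᶠ i in l, IsStripFunction s' K (g i))
    (hlim : ∀ z ∈ closedStrip s', Tendsto (fun i => g i z) l (𝓝 (g₀ z))) :
    IsStripFunction s K g₀ := by
  have hdiff : DifferentiableOn ℂ g₀ (strip s') :=
    (tendstoLocallyUniformlyOn_of_bounded (isOpen_strip s')
      (hg.mono fun i hi => hi.differentiableOn)
      (hg.mono fun i hi z hz => hi.norm_le z (strip_subset_closedStrip s' hz))
      fun z hz => hlim z (strip_subset_closedStrip s' hz)).differentiableOn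
      (hg.mono fun i hi => hi.differentiableOn) (isOpen_strip s')
  refine ⟨hdiff.continuousOn.mono (closedStrip_subset_strip hs), hdiff.mono (strip_mono hs.le),
    fun z hz => ?_, fun z hz => ?_⟩
  · have hz_mem := closedStrip_mono hs.le hz
    exact tendsto_nhds_unique (hlim _ (add_two_pi_mem_closedStrip hz_mem))
      ((hlim z hz_mem).congr' (hg.mono fun i hi => (hi.periodic z hz_mem).symm))
  · have hz_mem := closedStrip_mono hs.le hz
    exact le_of_tendsto (hlim z hz_mem).norm (hg.mono fun i hi => hi.norm_le z hz_mem)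

/-- The limits on the larger strip need not be continuous up to its boundary, which is why the
strip shrinks. -/
theorem isStripLimit_ofFun [l.NeBot] (hs : s < s') (hX : IsBoundedFamily l δ K X)
    {G : ℂ → ℂ → ℂ} (hlim : ∀ t ∈ Metric.ball 0 δ, ∀ z ∈ closedStrip s',
      Tendsto (fun i => val (X i t) z) l (𝓝 (G z t))) :
    IsStripLimit l δ X (fun t => ofFun s fun z => G z t) := by
  have hspace : ∀ t ∈ Metric.ball 0 δ, IsStripFunction s K (fun z => G z t) := fun t ht =>
    isStripFunction_of_tendsto hs (hX.isStripFunction_val ht) (hlim t ht)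
  have htime : ∀ z ∈ closedStrip s, DifferentiableOn ℂ (G z) (Metric.ball 0 δ) := fun z hz => by
    have hdiff := hX.holo.mono fun i hi => differentiableOn_val_apply hi z
    exact (tendstoLocallyUniformlyOn_of_bounded Metric.isOpen_ball hdiff
      (hX.norm_le.mono fun i hi t ht => (norm_val_le _ _).trans (hi t ht))
      fun t ht => hlim t ht z (closedStrip_mono hs.le hz)).differentiableOn hdiff
      Metric.isOpen_ball
  refine ⟨differentiableOn_ofFun Metric.isOpen_ball hspace htime, fun t ht z hz => ?_⟩
  rw [(hspace t ht).val_ofFun hz]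
  exact hlim t ht z (closedStrip_mono hs.le hz)

lemma exists_tendsto_of_ultrafilter {E : Type*} [NormedAddCommGroup E] [ProperSpace E]
    (U : Ultrafilter ι) {c : ι → E} (hc : ∀ᶠ i in U, ‖c i‖ ≤ K) : ∃ y, Tendsto c U (𝓝 y) := by
  have hle : (U.map c : Filter E) ≤ 𝓟 (Metric.closedBall 0 K) :=
    le_principal_iff.2 (hc.mono fun i hi => mem_closedBall_zero_iff.2 hi)
  obtain ⟨y, -, hy⟩ := (isCompact_closedBall (0 : E) K).ultrafilter_le_nhds _ hle
  exact ⟨y, hy⟩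

theorem exists_isStripLimit_ultrafilter (U : Ultrafilter ι) (hs : s < s')
    (hX : IsBoundedFamily (U : Filter ι) δ K X) : ∃ Y : ℂ → StripSpace s, IsStripLimit U δ X Y := by
  have hpt : ∀ z t : ℂ, t ∈ Metric.ball (0 : ℂ) δ →
      ∃ y, Tendsto (fun i => val (X i t) z) U (𝓝 y) := fun z t ht =>
    exists_tendsto_of_ultrafilter U
      (hX.norm_le.mono fun i hi => (norm_val_le _ z).trans (hi t ht))
  choose! G hG using hpt
  exact ⟨_, isStripLimit_ofFun hs hX fun t ht z _ => hG z t ht⟩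

lemma eqOn_of_eq_ofReal {V : Set ℂ} (hV : IsOpen V) (hVc : IsPreconnected V) (h0 : (0 : ℂ) ∈ V)
    {f g : ℂ → ℂ} (hf : DifferentiableOn ℂ f V) (hg : DifferentiableOn ℂ g V) {r : ℝ} (hr : 0 < r)
    (hfg : ∀ x : ℝ, x ∈ Ioo 0 r → f x = g x) : EqOn f g V := by
  have hreal : Tendsto (fun x : ℝ => (x : ℂ)) (𝓝[>] 0) (𝓝[≠] 0) := by
    refine tendsto_nhdsWithin_iff.2 ⟨?_, ?_⟩
    · exact (Complex.continuous_ofReal.tendsto' 0 0 Complex.ofReal_zero).mono_left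
        nhdsWithin_le_nhds
    · filter_upwards [self_mem_nhdsWithin] with x hx
      exact Complex.ofReal_ne_zero.2 (ne_of_gt hx)
  refine (hf.analyticOnNhd hV).eqOn_of_preconnected_of_frequently_eq (hg.analyticOnNhd hV) hVc h0
    (hreal.frequently (Eventually.frequently ?_))
  filter_upwards [Ioo_mem_nhdsGT hr] with x hx using hfg x hx

theorem eqOn_ball_of_eq_ofReal (hs : 0 < s) (hY : DifferentiableOn ℂ Y (Metric.ball 0 δ))
    (hZ : DifferentiableOn ℂ Z (Metric.ball 0 δ))
    (h : ∀ x : ℝ, ∀ t : ℝ, t ∈ Ico 0 δ → val (Y t) x = val (Z t) x) :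
    EqOn Y Z (Metric.ball 0 δ) := by
  intro t ht
  have hδ := Metric.pos_of_mem_ball ht
  have hreal : ∀ x : ℝ, val (Y t) x = val (Z t) x := fun x =>
    eqOn_of_eq_ofReal Metric.isOpen_ball (convex_ball _ _).isPreconnected
      (Metric.mem_ball_self hδ) (differentiableOn_val_apply hY x)
      (differentiableOn_val_apply hZ x) hδ (fun τ hτ => h x τ (Ioo_subset_Ico_self hτ)) ht
  exact val_ext_strip hs (eqOn_of_eq_ofReal (isOpen_strip s) (convex_strip s).isPreconnected
    (by simpa [mem_strip] using hs) (isStripFunction_val _).differentiableOn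
    (isStripFunction_val _).differentiableOn one_pos fun x _ => hreal x)

/-- A form of Vitali's theorem: all ultrafilter limits coincide as soon as their values on the real
axis at the times `t ∈ [0, δ)` are identified by some property `P`. -/
theorem exists_isStripLimit_of_unique [l.NeBot] (hs : 0 < s) (hss : s < s')
    (hX : IsBoundedFamily l δ K X) {P : (ℂ → StripSpace s) → Prop}
    (hP : ∀ U : Ultrafilter ι, (U : Filter ι) ≤ l → ∀ Y : ℂ → StripSpace s,
      IsStripLimit U δ X Y → P Y)
    (huniq : ∀ Y Z : ℂ → StripSpace s, P Y → P Z →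
      ∀ x : ℝ, ∀ t : ℝ, t ∈ Ico 0 δ → val (Y t) x = val (Z t) x) :
    ∃ Y : ℂ → StripSpace s, IsStripLimit l δ X Y ∧ P Y := by
  obtain ⟨Y, hY⟩ := exists_isStripLimit_ultrafilter (Ultrafilter.of l) hss
    (hX.mono (Ultrafilter.of_le l))
  have hPY := hP _ (Ultrafilter.of_le l) Y hY
  refine ⟨Y, ⟨hY.holo, fun t ht z hz => (tendsto_iff_ultrafilter _ _ _).2 fun U hU => ?_⟩, hPY⟩
  obtain ⟨Z, hZ⟩ := exists_isStripLimit_ultrafilter U hss (hX.mono hU)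
  rw [eqOn_ball_of_eq_ofReal hs hY.holo hZ.holo (huniq Y Z hPY (hP U hU Z hZ)) ht]
  exact hZ.tendsto t ht z hz

theorem IsStripLimit.tendstoLocallyUniformlyOn [l.NeBot] (hX : IsBoundedFamily l δ K X)
    (hY : IsStripLimit l δ X Y) (hs : s ≤ s') :
    TendstoLocallyUniformlyOn (fun i p => val (X i p.2) p.1) (fun p => val (Y p.2) p.1) l
      (strip s ×ˢ Metric.ball 0 δ) := by
  refine tendstoLocallyUniformlyOn_of_bounded (K := K) ((isOpen_strip s).prod Metric.isOpen_ball)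
    (hX.holo.mono fun i hi => ?_)
    (hX.norm_le.mono fun i hi p hp => (norm_val_le _ _).trans (hi p.2 hp.2))
    fun p hp => hY.tendsto p.2 hp.2 p.1 (strip_subset_closedStrip s hp.1)
  exact ((contDiffOn_val_joint Metric.isOpen_ball hi).differentiableOn one_ne_zero).mono
    (prod_mono (strip_mono hs) Subset.rfl)

end Families

/-! ### Passage to the limit in the equation -/

section Limit

variable {l : Filter ℝ} {s s₁ s₂ δ K M σ : ℝ} {X : ℝ → ℂ → StripSpace s₁}
  {U : ℝ → ℂ → StripSpace s₂} {Y V : ℂ → StripSpace s}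

lemma IsStripLimit.tendsto_deriv [l.NeBot] (hX : IsBoundedFamily l δ K X)
    (hY : IsStripLimit l δ X Y) {t z : ℂ} (ht : t ∈ Metric.ball 0 δ) (hz : z ∈ closedStrip s) :
    Tendsto (fun i => val (deriv (X i) t) z) l (𝓝 (val (deriv Y t) z)) := by
  have hval : ∀ {s : ℝ} {G : ℂ → StripSpace s}, DifferentiableOn ℂ G (Metric.ball 0 δ) →
      deriv (fun τ => val (G τ) z) t = val (deriv G t) z := fun {s G} hG =>
    ((evalL s z).hasFDerivAt.comp_hasDerivAt t
      (hG.differentiableAt (Metric.isOpen_ball.mem_nhds ht)).hasDerivAt).deriv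
  rw [← hval hY.holo]
  refine (tendsto_deriv_of_bounded (K := K) Metric.isOpen_ball
    (hX.holo.mono fun i hi => differentiableOn_val_apply hi z)
    (hX.norm_le.mono fun i hi τ hτ => (norm_val_le _ _).trans (hi τ hτ))
    (fun τ hτ => hY.tendsto τ hτ z hz) ht).congr' (hX.holo.mono fun i hi => hval hi)

lemma IsStripLimit.tendsto_differenceQuotient [l.NeBot] (hs₁ : s ≤ s₁) (hs₂ : s ≤ s₂)
    (hX : IsBoundedFamily l δ K X) (hY : IsStripLimit l δ X Y) (hU : IsBoundedFamily l δ M U)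
    (hV : IsStripLimit l δ U V) (hσ : |σ| = 1) (hl : l ≤ 𝓝[>] 0) {t z : ℂ}
    (ht : t ∈ Metric.ball 0 δ) (hz : z ∈ strip s) :
    Tendsto (fun ε : ℝ => (σ : ℂ) / ε * (val (X ε t) z * val (U ε t) z
      - val (X ε t) (z - σ * ε) * val (U ε t) (z - σ * ε))) l
      (𝓝 (deriv (fun w => val (Y t) w * val (V t) w) z)) := by
  have hσ2 : (σ : ℂ) * σ = 1 := by
    rw [← Complex.ofReal_mul, ← abs_mul_abs_self, hσ, mul_one, Complex.ofReal_one]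
  have hpos : ∀ᶠ ε : ℝ in l, 0 < ε := hl self_mem_nhdsWithin
  have hmul : ∀ᶠ ε in l, IsStripFunction s (K * M) fun w => val (X ε t) w * val (U ε t) w := by
    filter_upwards [hX.isStripFunction_val ht, hU.isStripFunction_val ht, hX.norm_le]
      with ε hXε hUε hKε
    exact (hXε.mono hs₁).mul (hUε.mono hs₂) ((norm_nonneg _).trans (hKε t ht))
  have hshift : Tendsto (fun ε : ℝ => (σ : ℂ) * ε) l (𝓝 0) :=
    (Continuous.tendsto' (by fun_prop) 0 0 (by simp)).mono_left (hl.trans nhdsWithin_le_nhds)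
  refine (tendsto_differenceQuotient_of_bounded (isOpen_strip s)
    (hmul.mono fun ε hε => hε.differentiableOn)
    (hmul.mono fun ε hε w hw => hε.norm_le w (strip_subset_closedStrip s hw))
    (fun w hw => (hY.tendsto t ht w (strip_subset_closedStrip s hw)).mul
      (hV.tendsto t ht w (strip_subset_closedStrip s hw))) hz hshift ?_).congr fun ε => ?_
  · filter_upwards [hpos] with ε hε
    exact mul_ne_zero (left_ne_zero_of_mul_eq_one hσ2) (Complex.ofReal_ne_zero.2 hε.ne')
  · rw [mul_inv, inv_eq_of_mul_eq_one_right hσ2, div_eq_mul_inv]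

theorem IsStripLimit.deriv_eq [l.NeBot] (hs₁ : s ≤ s₁) (hs₂ : s ≤ s₂)
    (hX : IsBoundedFamily l δ K X) (hY : IsStripLimit l δ X Y) (hU : IsBoundedFamily l δ M U)
    (hV : IsStripLimit l δ U V) (hσ : |σ| = 1) (hl : l ≤ 𝓝[>] 0) {f : ℝ → ℂ → ℂ → ℂ}
    {f₀ : ℂ → ℂ → ℂ} {g₀ : ℝ → ℂ → ℂ}
    (hode : ∀ᶠ ε in l, SolvesStripODE σ ε δ (fun z t => val (U ε t) z) (f ε) (g₀ ε) (X ε))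
    {t z : ℂ} (ht : t ∈ Metric.ball 0 δ) (hz : z ∈ strip s)
    (hf : Tendsto (fun ε => f ε z t) l (𝓝 (f₀ z t))) :
    val (deriv Y t) z = -deriv (fun w => val (Y t) w * val (V t) w) z - f₀ z t := by
  refine tendsto_nhds_unique (hY.tendsto_deriv hX ht (strip_subset_closedStrip s hz))
    (((hY.tendsto_differenceQuotient hs₁ hs₂ hX hU hV hσ hl ht hz).neg.sub hf).congr' ?_)
  filter_upwards [hode] with ε hε
  rw [hε.ode t ht z (strip_mono hs₁ hz), neg_mul]

end Limit

/-! ### Convergence of the approximations -/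

section Convergence

lemma mul_le_integral_add_of_periodic {d : ℝ → ℝ} {T ρ e x : ℝ} (a : ℝ) (hd : Continuous d)
    (hper : Function.Periodic d T) (hnonneg : ∀ y, 0 ≤ d y) (hρ : 0 ≤ ρ) (hρT : ρ ≤ T)
    (hle : ∀ y ∈ Icc x (x + ρ), d x ≤ d y + e) :
    ρ * d x ≤ (∫ y in a..a + T, d y) + ρ * e := by
  have hint : ∀ b c, IntervalIntegrable d volume b c := fun b c => hd.intervalIntegrable b c
  calc ρ * d x = ∫ _ in x..x + ρ, d x := by simp
    _ ≤ ∫ y in x..x + ρ, (d y + e) :=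
        intervalIntegral.integral_mono_on (by linarith) (by simp)
          ((hint _ _).add (by simp)) hle
    _ = (∫ y in x..x + ρ, d y) + ρ * e := by
        rw [intervalIntegral.integral_add (hint _ _) (by simp)]
        simp
    _ ≤ (∫ y in x..x + T, d y) + ρ * e := by
        gcongr
        exact intervalIntegral.integral_mono_interval le_rfl (by linarith) (by linarith)
          (Eventually.of_forall hnonneg) (hint _ _)
    _ = (∫ y in a..a + T, d y) + ρ * e := by rw [hper.intervalIntegral_add_eq x a]

lemma IsStripFunction.norm_ofReal_sub_le {s K : ℝ} {g : ℂ → ℂ} (hs : 0 < s)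
    (hg : IsStripFunction s K g) (x y : ℝ) : ‖g x - g y‖ ≤ K / s * |x - y| := by
  simpa using hg.norm_sub_shift_le hs (ofReal_mem_closedStrip le_rfl x) (x - y)

/-- Cauchy's estimate makes the family equicontinuous on the real axis, so that its distance to the
limit at `x` is controlled by the mean distance over a short interval. -/
theorem ConvergesL1Torus.tendsto_apply {s K : ℝ} (hs : 0 < s) {gε : ℝ → ℂ → ℂ} {g : ℝ → ℂ}
    (hgε : ∀ᶠ ε in 𝓝[>] 0, IsStripFunction s K (gε ε))
    (h : ConvergesL1Torus (fun ε x => gε ε x) g) (x : ℝ) :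
    Tendsto (fun ε => gε ε x) (𝓝[>] 0) (𝓝 (g x)) := by
  rw [tendsto_iff_norm_sub_tendsto_zero, Metric.tendsto_nhds]
  intro e he
  have hnear : ∀ᶠ y in 𝓝 x, K / s * |x - y| < e / 4 ∧ ‖g y - g x‖ < e / 4 :=
    (Continuous.tendsto' (by fun_prop) x 0 (by simp) |>.eventually_lt_const (by positivity)).and
      ((h.continuous.sub continuous_const).norm.tendsto' x 0 (by simp)
        |>.eventually_lt_const (by positivity))
  obtain ⟨ρ, hρ, hρπ, hρx⟩ : ∃ ρ > 0, ρ ≤ 2 * Real.pi ∧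
      ∀ y ∈ Icc x (x + ρ), K / s * |x - y| < e / 4 ∧ ‖g y - g x‖ < e / 4 := by
    obtain ⟨ρ, hρ, hρx⟩ := Metric.nhds_basis_closedBall.eventually_iff.1 hnear
    refine ⟨min ρ (2 * Real.pi), lt_min hρ Real.two_pi_pos, min_le_right _ _, fun y hy => hρx ?_⟩
    rw [Metric.mem_closedBall, Real.dist_eq, abs_of_nonneg (sub_nonneg.2 hy.1)]
    linarith [hy.2, min_le_left ρ (2 * Real.pi)]
  filter_upwards [hgε, h.tendsto.eventually_lt_const (show 0 < ρ * (e / 4) by positivity)]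
    with ε hε hI
  have hcont : Continuous fun y : ℝ => ‖gε ε y - g y‖ :=
    ((hε.continuousOn.comp_continuous Complex.continuous_ofReal
      fun y => ofReal_mem_closedStrip hs.le y).sub h.continuous).norm
  have hper : Function.Periodic (fun y : ℝ => ‖gε ε y - g y‖) (2 * Real.pi) := fun y => by
    have := hε.periodic y (ofReal_mem_closedStrip hs.le y)
    simp only [h.periodic y, Complex.ofReal_add, Complex.ofReal_mul, Complex.ofReal_ofNat, this]
  have hmean := mul_le_integral_add_of_periodic (x := x) (e := e / 2) (-Real.pi) hcont hper
    (fun _ => norm_nonneg _) hρ.le hρπ fun y hy => by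
      have htri := norm_add₃_le (a := gε ε x - gε ε y) (b := gε ε y - g y) (c := g y - g x)
      rw [sub_add_sub_cancel, sub_add_sub_cancel] at htri
      linarith [hε.norm_ofReal_sub_le hs x y, hρx y hy]
  rw [show -Real.pi + 2 * Real.pi = Real.pi by ring] at hmean
  rw [Real.dist_0_eq_abs, abs_norm]
  nlinarith

variable {s s₁ s₂ δ K M σ : ℝ} {X : ℝ → ℂ → StripSpace s₁} {U : ℝ → ℂ → StripSpace s₂}
  {V : ℂ → StripSpace s} {u : ℝ → ℝ → ℝ}

theorem exists_isStripLimit_of_tendsto_ofReal (hs : 0 < s) (hs₂ : s < s₂)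
    (hU : IsBoundedFamily (𝓝[>] 0) δ M U) (hu : ∀ x : ℝ, ∀ t : ℝ, t ∈ Ico 0 δ →
      Tendsto (fun ε => val (U ε t) x) (𝓝[>] 0) (𝓝 (u x t))) :
    ∃ V : ℂ → StripSpace s, IsStripLimit (𝓝[>] 0) δ U V ∧
      ∀ x : ℝ, ∀ t : ℝ, t ∈ Ico 0 δ → val (V t) x = u x t :=
  exists_isStripLimit_of_unique hs hs₂ hU
    (fun _ hl _ hV x t ht => tendsto_nhds_unique
      (hV.tendsto t (ofReal_mem_ball ht) x (ofReal_mem_closedStrip hs.le x))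
      ((hu x t ht).mono_left hl))
    fun _ _ hY hZ x t ht => (hY x t ht).trans (hZ x t ht).symm

/-- Every ultrafilter limit of the `X ε` is a classical solution, and there is only one. -/
theorem exists_isStripLimit_isClassicalSolution (hs : 0 < s) (hs₁ : s < s₁) (hs₂ : s ≤ s₂)
    (hδ : 0 < δ) (hσ : |σ| = 1) (hX : IsBoundedFamily (𝓝[>] 0) δ K X)
    (hU : IsBoundedFamily (𝓝[>] 0) δ M U) (hV : IsStripLimit (𝓝[>] 0) δ U V)
    (hVu : ∀ x : ℝ, ∀ t : ℝ, t ∈ Ico 0 δ → val (V t) x = u x t)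
    {f : ℝ → ℂ → ℂ → ℂ} {f₀ : ℂ → ℂ → ℂ} {g₀ : ℝ → ℂ → ℂ} {y₀ : ℝ → ℂ}
    (hode : ∀ᶠ ε in 𝓝[>] 0,
      SolvesStripODE σ ε δ (fun z t => val (U ε t) z) (f ε) (g₀ ε) (X ε))
    (hf : ∀ t ∈ Metric.ball 0 δ, ∀ z ∈ strip s,
      Tendsto (fun ε => f ε z t) (𝓝[>] 0) (𝓝 (f₀ z t)))
    (hinit : ∀ x : ℝ, Tendsto (fun ε => g₀ ε x) (𝓝[>] 0) (𝓝 (y₀ x))) :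
    ∃ Y : ℂ → StripSpace s, IsStripLimit (𝓝[>] 0) δ X Y ∧
      IsClassicalSolution δ u (fun x t => f₀ x t) y₀ (fun x t => val (Y t) x) := by
  refine exists_isStripLimit_of_unique hs hs₁ hX (fun l hl Y hY => ?_)
    fun Y Z hY hZ x t ht => hY.eq_of_val hs (fun t ht => hV.norm_le hU ht) hVu hZ x ht
  refine isClassicalSolution_val hs hY.holo hVu (fun x => ?_) (fun t ht z hz => ?_)
    fun _ _ _ => rfl
  · have hx := ofReal_mem_closedStrip hs.le x
    refine tendsto_nhds_unique (hY.tendsto 0 (Metric.mem_ball_self hδ) x hx)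
      (((hinit x).mono_left hl).congr' ?_)
    filter_upwards [hl hode] with ε hε using (hε.init x (closedStrip_mono hs₁.le hx)).symm
  · exact hY.deriv_eq hs₁.le hs₂ (hX.mono hl) (hU.mono hl) (hV.mono hl) hσ hl (hl hode) ht hz
      ((hf t ht z hz).mono_left hl)

end Convergence

/-! ### Families depending on the small parameter -/

section UpwindFamilies

/-- For `0 < ε < 1` the functions `f ε z t` of `z` form a holomorphic map `{|t| < δ} → E_s` bounded
by `K`. The map is given by its values, so that coefficients and sources need not be converted to
elements of `StripSpace s`. -/
structure IsStripFamily (s δ K : ℝ) (f : ℝ → ℂ → ℂ → ℂ) : Prop where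
  space : ∀ ε ∈ Ioo (0 : ℝ) 1, ∀ t ∈ Metric.ball 0 δ, IsStripFunction s K (fun z => f ε z t)
  time : ∀ ε ∈ Ioo (0 : ℝ) 1, ∀ z ∈ closedStrip s, DifferentiableOn ℂ (f ε z) (Metric.ball 0 δ)

/-- For `0 < ε < 1` the maps `X ε : {|t| < δ} → E_s` solve the approximating equations and are
bounded by `K`. -/
structure IsUpwindFamily (σ δ K : ℝ) {s : ℝ} (u f : ℝ → ℂ → ℂ → ℂ) (g : ℝ → ℂ → ℂ)
    (X : ℝ → ℂ → StripSpace s) : Prop where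
  solves : ∀ ε ∈ Ioo (0 : ℝ) 1, SolvesStripODE σ ε δ (u ε) (f ε) (g ε) (X ε)
  norm_le : ∀ ε ∈ Ioo (0 : ℝ) 1, ∀ t ∈ Metric.ball 0 δ, ‖X ε t‖ ≤ K

variable {s s' s₁ s₂ δ σ B F K M : ℝ} {u f f' : ℝ → ℂ → ℂ → ℂ} {g : ℝ → ℂ → ℂ}

lemma eventually_mem_Ioo_zero_one : ∀ᶠ ε : ℝ in 𝓝[>] 0, ε ∈ Ioo (0 : ℝ) 1 :=
  Ioo_mem_nhdsGT zero_lt_one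

namespace IsStripFamily

lemma zero : IsStripFamily s δ 0 (fun _ _ _ => 0) where
  space _ _ _ _ := ⟨continuousOn_const, differentiableOn_const 0, fun _ _ => rfl, by simp⟩
  time _ _ _ _ := differentiableOn_const 0

lemma mono (hf : IsStripFamily s' δ K f) (hs : s ≤ s') : IsStripFamily s δ K f where
  space ε hε t ht := (hf.space ε hε t ht).mono hs
  time ε hε z hz := hf.time ε hε z (closedStrip_mono hs hz)

lemma differentiableOn_ofFun (hf : IsStripFamily s δ K f) {ε : ℝ} (hε : ε ∈ Ioo (0 : ℝ) 1) :
    DifferentiableOn ℂ (fun t => ofFun s fun z => f ε z t) (Metric.ball 0 δ) :=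
  WeakAsymptotic.differentiableOn_ofFun Metric.isOpen_ball (hf.space ε hε) (hf.time ε hε)

lemma norm_ofFun_le (hf : IsStripFamily s δ K f) (hs : 0 ≤ s) {ε : ℝ} (hε : ε ∈ Ioo (0 : ℝ) 1)
    {t : ℂ} (ht : t ∈ Metric.ball 0 δ) : ‖ofFun s fun z => f ε z t‖ ≤ K :=
  (hf.space ε hε t ht).norm_ofFun_le ((hf.space ε hε t ht).nonneg hs)

lemma isBoundedFamily (hf : IsStripFamily s δ K f) (hs : 0 ≤ s) :
    IsBoundedFamily (𝓝[>] 0) δ K (fun ε t => ofFun s fun z => f ε z t) where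
  holo := eventually_mem_Ioo_zero_one.mono fun _ hε => hf.differentiableOn_ofFun hε
  norm_le := eventually_mem_Ioo_zero_one.mono fun _ hε _ ht => hf.norm_ofFun_le hs hε ht

theorem exists_isStripLimit {u₀ : ℝ → ℝ → ℝ} (hu : IsStripFamily s' δ M u) (hs : 0 < s)
    (hs' : s < s') (hlim : ∀ t ∈ Ico 0 δ, ConvergesL1Torus (fun ε x => u ε x t) (fun x => u₀ x t)) :
    ∃ V : ℂ → StripSpace s, IsStripLimit (𝓝[>] 0) δ (fun ε t => ofFun s' fun z => u ε z t) V ∧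
      ∀ x : ℝ, ∀ t : ℝ, t ∈ Ico 0 δ → val (V t) x = u₀ x t := by
  have hs₀ := hs.trans hs'
  refine exists_isStripLimit_of_tendsto_ofReal hs hs' (hu.isBoundedFamily hs₀.le)
    fun x t ht => ?_
  have hstrip : ∀ᶠ ε : ℝ in 𝓝[>] 0, IsStripFunction s' M (fun z => u ε z t) :=
    eventually_mem_Ioo_zero_one.mono fun ε hε => hu.space ε hε t (ofReal_mem_ball ht)
  refine ((hlim t ht).tendsto_apply hs₀ hstrip x).congr' (hstrip.mono fun ε hε => ?_)
  exact (hε.val_ofFun (ofReal_mem_closedStrip hs₀.le x)).symm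

theorem exists_isUpwindFamily (hu : IsStripFamily s' δ M u) (hf : IsStripFamily s' δ F f)
    (hg : ∀ ε ∈ Ioo (0 : ℝ) 1, IsStripFunction s' B (g ε)) (hσ : |σ| = 1) (hδ : 0 < δ)
    (hs' : 0 ≤ s') (hs : s < s') (hδs : 2 * Real.exp 1 * M * δ ≤ s' - s) :
    ∃ X : ℝ → ℂ → StripSpace s, IsUpwindFamily σ δ (2 * (B + F * δ)) u f g X := by
  suffices h : ∀ ε ∈ Ioo (0 : ℝ) 1, ∃ X : ℂ → StripSpace s,
      SolvesStripODE σ ε δ (u ε) (f ε) (g ε) X ∧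
        ∀ t ∈ Metric.ball 0 δ, ‖X t‖ ≤ 2 * (B + F * δ) by
    choose! X hsolves hnorm using h
    exact ⟨X, hsolves, hnorm⟩
  intro ε hε
  obtain ⟨X, hX, hnorm⟩ := exists_solvesStripODE (x₀ := ofFun s' (g ε)) hσ hε.1 hδ hs hδs
    (hu.differentiableOn_ofFun hε) (fun t ht => hu.norm_ofFun_le hs' hε ht)
    (hf.differentiableOn_ofFun hε) (fun t ht => hf.norm_ofFun_le hs' hε ht)
  have hval : ∀ {k : ℝ → ℂ → ℂ → ℂ} {L : ℝ}, IsStripFamily s' δ L k →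
      ∀ t ∈ Metric.ball (0 : ℂ) δ, ∀ z ∈ strip s, val (ofFun s' fun z => k ε z t) z = k ε z t :=
    fun hk t ht z hz =>
      (hk.space ε hε t ht).val_ofFun (closedStrip_mono hs.le (strip_subset_closedStrip s hz))
  refine ⟨X, hX.congr (hval hu) (hval hf)
    fun z hz => (hg ε hε).val_ofFun (closedStrip_mono hs.le hz), fun t ht => ?_⟩
  refine (hnorm t ht).trans ?_
  gcongr
  exact (hg ε hε).norm_ofFun_le ((hg ε hε).nonneg hs')

lemma solvesStripODE_eqOn (hu : IsStripFamily s' δ M u) (hs : 0 < s) (hs' : s ≤ s') {ε : ℝ}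
    (hε : ε ∈ Ioo (0 : ℝ) 1) {k : ℂ → ℂ → ℂ} {g₀ : ℂ → ℂ} {X Y : ℂ → StripSpace s}
    (hX : SolvesStripODE σ ε δ (u ε) k g₀ X) (hY : SolvesStripODE σ ε δ (u ε) k g₀ Y) :
    EqOn X Y (Metric.ball 0 δ) :=
  hX.eqOn hs (fun t ht z hz => (hu.space ε hε t ht).norm_le z
    (closedStrip_mono hs' (strip_subset_closedStrip s hz))) hY

end IsStripFamily

namespace IsUpwindFamily

variable {X : ℝ → ℂ → StripSpace s₁}

lemma isBoundedFamily (hX : IsUpwindFamily σ δ K u f g X) : IsBoundedFamily (𝓝[>] 0) δ K X where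
  holo := eventually_mem_Ioo_zero_one.mono fun ε hε => (hX.solves ε hε).holo
  norm_le := eventually_mem_Ioo_zero_one.mono hX.norm_le

lemma congr (hX : IsUpwindFamily σ δ K u f g X)
    (hf : ∀ ε ∈ Ioo (0 : ℝ) 1, ∀ t ∈ Metric.ball (0 : ℂ) δ, ∀ z ∈ strip s₁, f ε z t = f' ε z t) :
    IsUpwindFamily σ δ K u f' g X where
  solves ε hε := (hX.solves ε hε).congr (fun _ _ _ _ => rfl) (hf ε hε) fun _ _ => rfl
  norm_le := hX.norm_le

lemma restrict (hX : IsUpwindFamily σ δ K u f g X) (hs : s ≤ s₁) :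
    IsUpwindFamily σ δ K u f g (fun ε t => restrictL hs (X ε t)) where
  solves ε hε := (hX.solves ε hε).restrict hs
  norm_le ε hε t ht := (norm_restrictL_le hs _).trans (hX.norm_le ε hε t ht)

lemma uniformlyBounded (hX : IsUpwindFamily σ δ K u f g X) : UniformlyBounded δ X :=
  fun _ hρ => ⟨K, fun ε hε t ht => hX.norm_le ε hε t (mem_ball_zero_iff.2 (ht.trans_lt hρ))⟩

lemma convergesOnCompacts {Y : ℂ → StripSpace s} (hX : IsUpwindFamily σ δ K u f g X) (hs : s ≤ s₁)
    (hY : IsStripLimit (𝓝[>] 0) δ X Y) :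
    ConvergesOnCompacts δ (fun ε t => restrictL hs (X ε t)) Y := by
  intro Q hQ hsub
  have hloc := hY.tendstoLocallyUniformlyOn hX.isBoundedFamily hs
  refine ((tendstoLocallyUniformlyOn_iff_forall_isCompact
    ((isOpen_strip s).prod Metric.isOpen_ball)).1 hloc Q hsub hQ).congr
    (Eventually.of_forall fun ε p hp => ?_)
  exact (val_restrictL hs _ (strip_subset_closedStrip s (hsub hp).1)).symm

theorem exists_isStripLimit {U₀ : ℂ → StripSpace s} {u₀ : ℝ → ℝ → ℝ} {f₀ : ℂ → ℂ → ℂ} {y₀ : ℝ → ℂ}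
    (hX : IsUpwindFamily σ δ K u f g X) (hu : IsStripFamily s₂ δ M u) (hs : 0 < s) (hs₁ : s < s₁)
    (hs₂ : s₁ ≤ s₂) (hδ : 0 < δ) (hσ : |σ| = 1)
    (hU : IsStripLimit (𝓝[>] 0) δ (fun ε t => ofFun s₂ fun z => u ε z t) U₀)
    (hUu : ∀ x : ℝ, ∀ t : ℝ, t ∈ Ico 0 δ → val (U₀ t) x = u₀ x t)
    (hf : ∀ t ∈ Metric.ball 0 δ, ∀ z ∈ strip s,
      Tendsto (fun ε => f ε z t) (𝓝[>] 0) (𝓝 (f₀ z t)))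
    (hg : ∀ ε ∈ Ioo (0 : ℝ) 1, IsStripFunction s B (g ε))
    (hy₀ : ConvergesL1Torus (fun ε x => g ε x) y₀) :
    ∃ Y : ℂ → StripSpace s, IsStripLimit (𝓝[>] 0) δ X Y ∧
      IsClassicalSolution δ u₀ (fun x t => f₀ x t) y₀ (fun x t => val (Y t) x) := by
  have hs₂' : 0 ≤ s₂ := hs.le.trans (hs₁.le.trans hs₂)
  refine exists_isStripLimit_isClassicalSolution hs hs₁ (hs₁.le.trans hs₂) hδ hσ
    hX.isBoundedFamily (hu.isBoundedFamily hs₂') hU hUu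
    (eventually_mem_Ioo_zero_one.mono fun ε hε => ?_) hf
    (hy₀.tendsto_apply hs (eventually_mem_Ioo_zero_one.mono hg))
  refine (hX.solves ε hε).congr (fun t ht z hz => ?_) (fun _ _ _ _ => rfl) fun _ _ => rfl
  exact ((hu.space ε hε t ht).val_ofFun
    (closedStrip_mono hs₂ (strip_subset_closedStrip s₁ hz))).symm

lemma isStripFamily_pressureGradC {φ : ℝ → ℝ} {h : ℝ → ℝ} (hX : IsUpwindFamily σ δ K u f g X)
    (n : ℕ) (hφ : Integrable φ) (hh : ∀ ε ∈ Ioo (0 : ℝ) 1, 0 < h ε) (hs : s < s₁) (hs₁ : 0 ≤ s₁) :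
    IsStripFamily s δ (n * ((∫ y, ‖φ y‖) * K) ^ (n - 1) * ((∫ y, ‖φ y‖) * K / (s₁ - s)))
      (fun ε z t => pressureGradC n φ (h ε) (val (X ε t)) z) where
  space ε hε t ht := isStripFunction_pressureGradC n hφ (hh ε hε) hs hs₁
    ((isStripFunction_val (X ε t)).mono_bound (hX.norm_le ε hε t ht))
  time ε hε _ hz := differentiableOn_pressureGradC n hφ (hh ε hε) (hX.solves ε hε).holo
    (closedStrip_subset_strip hs hz)

lemma tendsto_pressureGradC {φ : ℝ → ℝ} {h : ℝ → ℝ} {Y : ℂ → StripSpace s}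
    (hX : IsUpwindFamily σ δ K u f g X) (hY : IsStripLimit (𝓝[>] 0) δ X Y) (n : ℕ)
    (hφ : ∫ y, φ y = 1) (hh : Tendsto h (𝓝[>] 0) (𝓝[>] 0)) (hs : s ≤ s₁) {t z : ℂ}
    (ht : t ∈ Metric.ball 0 δ) (hz : z ∈ strip s) :
    Tendsto (fun ε => pressureGradC n φ (h ε) (val (X ε t)) z) (𝓝[>] 0)
      (𝓝 (deriv (fun w => val (Y t) w ^ n) z)) := by
  have hfam := hX.isBoundedFamily
  refine WeakAsymptotic.tendsto_pressureGradC n hφ hh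
    ((hfam.isStripFunction_val ht).mono fun _ h => h.mono hs)
    ((norm_nonneg _).trans (hY.norm_le hfam ht))
    (fun w hw => hY.tendsto t ht w (strip_subset_closedStrip s hw)) hz

end IsUpwindFamily

/-- Half of the loss of strip pays for solving each of the two equations; the pressure gradient
costs only an arbitrarily small part. -/
theorem IsStripFamily.exists_isUpwindFamily_pressureGradC {v w : ℝ → ℂ → ℂ} {φ h : ℝ → ℝ}
    (hu : IsStripFamily s' δ M u) (hv : ∀ ε ∈ Ioo (0 : ℝ) 1, IsStripFunction s' B (v ε))
    (hw : ∀ ε ∈ Ioo (0 : ℝ) 1, IsStripFunction s' B (w ε)) (n : ℕ) (hφ : Integrable φ)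
    (hh : ∀ ε ∈ Ioo (0 : ℝ) 1, 0 < h ε) (hσ : |σ| = 1) (hδ : 0 < δ) (hs : 0 ≤ s) (hs' : s < s')
    (hδs : 4 * Real.exp 1 * M * δ < s' - s) :
    ∃ (K L : ℝ) (X W : ℝ → ℂ → StripSpace s), IsUpwindFamily σ δ K u (fun _ _ _ => 0) v X ∧
      IsUpwindFamily σ δ L u (fun ε z t => pressureGradC n φ (h ε) (val (X ε t)) z) w W := by
  obtain ⟨q, hq, hqs⟩ := exists_between (show max 0 (2 * Real.exp 1 * M * δ) < (s' - s) / 2 from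
    max_lt (by linarith) (by linarith))
  obtain ⟨hq₀, hMq⟩ := max_lt_iff.1 hq
  have hsq : s ≤ s' - q := by linarith
  have hsub : s + q ≤ s' := by linarith
  obtain ⟨X, hX⟩ := hu.exists_isUpwindFamily (s := s' - q) .zero hv hσ hδ (hs.trans hs'.le)
    (sub_lt_self s' hq₀) (by linarith)
  obtain ⟨W, hW⟩ := (hu.mono hsub).exists_isUpwindFamily (s := s)
    (hX.isStripFamily_pressureGradC n hφ hh (by linarith) (hs.trans hsq))
    (fun ε hε => (hw ε hε).mono hsub) hσ hδ (by linarith) (by linarith) (by linarith)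
  exact ⟨_, _, _, W, hX.restrict hsq,
    hW.congr fun ε _ t _ z hz => (pressureGradC_restrictL n hsq (X ε t) hz).symm⟩

end UpwindFamilies

/-! ### The analytic data -/

section AnalyticData

variable {r s s₀ a δ B M σ η ε : ℝ} {u : ℝ → ℂ → ℂ → ℂ} {X : ℂ → StripSpace s}

lemma AnalyticDatum.isStripFunction {g : ℝ → ℂ → ℂ} (hg : AnalyticDatum r s₀ B g) (hr : s₀ < r)
    (hε : ε ∈ Ioo (0 : ℝ) 1) : IsStripFunction s₀ B (g ε) where
  continuousOn := (hg.holo ε hε).continuousOn.mono (closedStrip_subset_strip hr)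
  differentiableOn := (hg.holo ε hε).mono (strip_mono hr.le)
  periodic z hz := hg.periodic ε hε z (closedStrip_subset_strip hr hz)
  norm_le := hg.bounded ε hε

lemma abs_lt_of_mem_Ico (hδ : δ ≤ a) {t : ℝ} (ht : t ∈ Ico 0 δ) : |t| < a :=
  (abs_of_nonneg ht.1).trans_lt (ht.2.trans_le hδ)

namespace AnalyticCoefficient

lemma isStripFamily (hu : AnalyticCoefficient r s₀ a M σ η u) (hr : s₀ < r) (hδ : δ ≤ a) :
    IsStripFamily s₀ δ M u where
  space ε hε t ht := by
    have hball := Metric.ball_subset_ball hδ ht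
    have hsub := closedStrip_subset_strip hr
    have hd : DifferentiableOn ℂ (fun z => u ε z t) (strip r) :=
      (hu.holo ε hε).comp (f := fun z => (z, t))
        (differentiableOn_id.prodMk (differentiableOn_const t)) fun z hz => ⟨hz, hball⟩
    exact ⟨hd.continuousOn.mono hsub, hd.mono (strip_mono hr.le),
      fun z hz => hu.periodic ε hε z (hsub hz) t hball,
      fun z hz => hu.bounded ε hε z hz t hball⟩
  time ε hε z hz := (hu.holo ε hε).comp (f := fun t => (z, t))
    ((differentiableOn_const z).prodMk differentiableOn_id)
    fun t ht => ⟨closedStrip_subset_strip hr hz, Metric.ball_subset_ball hδ ht⟩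

lemma solvesUpwindODE (hu : AnalyticCoefficient r s₀ a M σ η u) (hδ : δ ≤ a) (hs : 0 < s)
    (hσ : σ = 1 ∨ σ = -1) (hη : 0 ≤ η) (hε : ε ∈ Ioo (0 : ℝ) 1) {f : ℂ → ℂ → ℂ} {g₀ : ℂ → ℂ}
    (hX : SolvesStripODE σ ε δ (u ε) f g₀ X) {k : ℝ → ℝ → ℂ}
    (hf : ∀ x : ℝ, ∀ t ∈ Ico 0 δ, f x (t : ℝ) = k x t) :
    SolvesUpwindODE ε δ (fun x t => (u ε x t).re) k (fun x => g₀ x)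
      (fun t => restrictReal hs (X t)) :=
  hX.solvesUpwindODE hs hσ (fun x t ht => hu.real ε hε x t (abs_lt_of_mem_Ico hδ ht))
    (fun x t ht => hη.trans (hu.sign ε hε x t (abs_lt_of_mem_Ico hδ ht))) hf

lemma upwindODE_eqOn (hu : AnalyticCoefficient r s₀ a M σ η u) (hδ : δ ≤ a) (hs₀ : 0 ≤ s₀)
    (hε : ε ∈ Ioo (0 : ℝ) 1) {k : ℝ → ℝ → ℂ} {g₀ : ℝ → ℂ} {Y Z : ℝ → ℝ →ᵇ ℂ}
    (hY : SolvesUpwindODE ε δ (fun x t => (u ε x t).re) k g₀ Y)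
    (hZ : SolvesUpwindODE ε δ (fun x t => (u ε x t).re) k g₀ Z) : EqOn Y Z (Ico 0 δ) :=
  hY.eqOn hε.1 (fun x t ht => (Complex.abs_re_le_norm _).trans
    (hu.bounded ε hε x (ofReal_mem_closedStrip hs₀ x) t
      (Metric.ball_subset_ball hδ (ofReal_mem_ball ht)))) hZ

end AnalyticCoefficient

lemma deriv_comp_ofReal_val_pow (hs : 0 < s) (f : StripSpace s) (n : ℕ) (x : ℝ) :
    deriv (fun ξ : ℝ => val f ξ ^ n) x = deriv (fun w => val f w ^ n) x :=
  (hasDerivAt_comp_ofReal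
    ((differentiableAt_val f (ofReal_mem_strip hs x)).pow n).hasDerivAt).deriv

lemma tendsto_rpow_nhdsGT_zero {α : ℝ} (hα : 0 < α) :
    Tendsto (fun ε : ℝ => ε ^ α) (𝓝[>] 0) (𝓝[>] 0) := by
  refine tendsto_nhdsWithin_iff.2 ⟨?_, eventually_mem_nhdsWithin.mono
    fun ε hε => Real.rpow_pos_of_pos hε α⟩
  simpa only [Real.zero_rpow hα.ne'] using
    (Real.continuousAt_rpow_const 0 α (Or.inr hα.le)).tendsto.mono_left nhdsWithin_le_nhds

end AnalyticData

end WeakAsymptotic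

end

open WeakAsymptotic in
theorem mainTheorem3_general {M r s₀ a σ η B s δ : ℝ} {φ h : ℝ → ℝ}
    {uε : ℝ → ℂ → ℂ → ℂ} {v₀ε w₀ε : ℝ → ℂ → ℂ} {u : ℝ → ℝ → ℝ} {v₀ w₀ : ℝ → ℂ} (n : ℕ)
    (hr : s₀ < r) (hσ : σ = 1 ∨ σ = -1) (hη : 0 ≤ η) (hφ : ∫ y, φ y = 1)
    (hh : ∀ ε ∈ Set.Ioo (0 : ℝ) 1, 0 < h ε) (hh₀ : Tendsto h (𝓝[>] 0) (𝓝[>] 0))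
    (huε : AnalyticCoefficient r s₀ a M σ η uε)
    (hv₀ε : AnalyticDatum r s₀ B v₀ε) (hw₀ε : AnalyticDatum r s₀ B w₀ε)
    (hu : ∀ t ∈ Set.Ico 0 a, ConvergesL1Torus (fun ε x => uε ε x t) (fun x => (u x t : ℂ)))
    (hv₀ : ConvergesL1Torus (fun ε x => v₀ε ε x) v₀)
    (hw₀ : ConvergesL1Torus (fun ε x => w₀ε ε x) w₀)
    (hs : 0 < s) (hss₀ : s < s₀) (hδ : 0 < δ) (hδa : δ ≤ a)
    (hδM : 4 * Real.exp 1 * M * δ < s₀ - s) :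
    ∃ (Xε Wε : ℝ → ℂ → StripSpace s) (X W : ℂ → StripSpace s),
      (∀ ε ∈ Set.Ioo (0 : ℝ) 1,
        SolvesStripODE σ ε δ (uε ε) (fun _ _ => 0) (v₀ε ε) (Xε ε) ∧
        (∀ Y : ℂ → StripSpace s,
          SolvesStripODE σ ε δ (uε ε) (fun _ _ => 0) (v₀ε ε) Y →
            Set.EqOn Y (Xε ε) (Metric.ball 0 δ)) ∧
        SolvesStripODE σ ε δ (uε ε)
          (fun z t => pressureGradC n φ (h ε) (val (Xε ε t)) z) (w₀ε ε) (Wε ε) ∧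
        (∀ Y : ℂ → StripSpace s,
          SolvesStripODE σ ε δ (uε ε)
            (fun z t => pressureGradC n φ (h ε) (val (Xε ε t)) z) (w₀ε ε) Y →
            Set.EqOn Y (Wε ε) (Metric.ball 0 δ))) ∧
      (∀ ε ∈ Set.Ioo (0 : ℝ) 1,
        SolvesUpwindODE ε δ (fun x t => (uε ε x t).re) (fun _ _ => 0) (fun x => v₀ε ε x)
          (fun t => restrictReal hs (Xε ε t)) ∧
        (∀ Y : ℝ → BoundedContinuousFunction ℝ ℂ,
          SolvesUpwindODE ε δ (fun x t => (uε ε x t).re) (fun _ _ => 0) (fun x => v₀ε ε x) Y →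
            ∀ t ∈ Set.Ico 0 δ, Y t = restrictReal hs (Xε ε t)) ∧
        SolvesUpwindODE ε δ (fun x t => (uε ε x t).re)
          (fun x t => pressureGrad n φ (h ε) (restrictReal hs (Xε ε t)) x)
            (fun x => w₀ε ε x)
          (fun t => restrictReal hs (Wε ε t)) ∧
        (∀ Y : ℝ → BoundedContinuousFunction ℝ ℂ,
          SolvesUpwindODE ε δ (fun x t => (uε ε x t).re)
            (fun x t => pressureGrad n φ (h ε) (restrictReal hs (Xε ε t)) x)
            (fun x => w₀ε ε x) Y →
            ∀ t ∈ Set.Ico 0 δ, Y t = restrictReal hs (Wε ε t))) ∧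
      UniformlyBounded δ Xε ∧ UniformlyBounded δ Wε ∧
      DifferentiableOn ℂ X (Metric.ball 0 δ) ∧ DifferentiableOn ℂ W (Metric.ball 0 δ) ∧
      IsClassicalSolution δ u (fun _ _ => 0) v₀ (fun x t => val (X t) x) ∧
      (∀ Y : ℝ → ℝ → ℂ, IsClassicalSolution δ u (fun _ _ => 0) v₀ Y →
        ∀ x : ℝ, ∀ t ∈ Set.Ico 0 δ, Y x t = val (X t) x) ∧
      IsClassicalSolution δ u (fun x t => deriv (fun ξ : ℝ => val (X t) ξ ^ n) x) w₀
        (fun x t => val (W t) x) ∧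
      (∀ Y : ℝ → ℝ → ℂ,
        IsClassicalSolution δ u (fun x t => deriv (fun ξ : ℝ => val (X t) ξ ^ n) x) w₀ Y →
        ∀ x : ℝ, ∀ t ∈ Set.Ico 0 δ, Y x t = val (W t) x) ∧
      ConvergesOnCompacts δ Xε X ∧ ConvergesOnCompacts δ Wε W := by
  have hφint : Integrable φ := integrable_of_integral_eq_one hφ
  have hσ' : |σ| = 1 := by rcases hσ with rfl | rfl <;> simp
  have hs₀ := hs.trans hss₀
  have hfam := huε.isStripFamily hr hδa
  obtain ⟨s₁, hs₁, hs₁₀⟩ := exists_between (lt_min hss₀ (lt_sub_comm.1 hδM))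
  obtain ⟨hs₁₀, hδs₁⟩ := lt_min_iff.1 hs₁₀
  obtain ⟨V, hV, hVu⟩ := hfam.exists_isStripLimit hs hss₀
    fun t ht => hu t ⟨ht.1, ht.2.trans_le hδa⟩
  obtain ⟨K, L, X', W', hX', hW'⟩ := hfam.exists_isUpwindFamily_pressureGradC
    (fun _ => hv₀ε.isStripFunction hr) (fun _ => hw₀ε.isStripFunction hr) n hφint hh hσ' hδ
    (hs.trans hs₁).le hs₁₀ (lt_sub_comm.1 hδs₁)
  obtain ⟨X, hX, hXcl⟩ := hX'.exists_isStripLimit hfam hs hs₁ hs₁₀.le hδ hσ' hV hVu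
    (fun _ _ _ _ => tendsto_const_nhds)
    (fun _ hε => (hv₀ε.isStripFunction hr hε).mono hss₀.le) hv₀
  obtain ⟨W, hW, hWcl⟩ := hW'.exists_isStripLimit hfam hs hs₁ hs₁₀.le hδ
    hσ' hV hVu (fun _ ht _ hz => hX'.tendsto_pressureGradC hX n hφ hh₀ hs₁.le ht hz)
    (fun _ hε => (hw₀ε.isStripFunction hr hε).mono hss₀.le) hw₀
  simp only [← deriv_comp_ofReal_val_pow hs] at hWcl
  have hXε := hX'.restrict hs₁.le
  have hWε := (hW'.restrict hs₁.le).congr fun ε _ t _ z hz =>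
    (pressureGradC_restrictL n hs₁.le (X' ε t) hz).symm
  have hXup := fun ε hε => huε.solvesUpwindODE hδa hs hσ hη hε (hXε.solves ε hε)
    (k := fun _ _ => 0) (fun _ _ _ => rfl)
  have hWup := fun ε hε => huε.solvesUpwindODE hδa hs hσ hη hε (hWε.solves ε hε)
    (fun x t _ => pressureGradC_ofReal n hs hφint (hh ε hε) _ x)
  have hVM := fun t ht => hV.norm_le (hfam.isBoundedFamily hs₀.le) (t := t) ht
  exact ⟨_, _, X, W,
    fun ε hε => ⟨hXε.solves ε hε,
      fun Y hY => hfam.solvesStripODE_eqOn hs hss₀.le hε hY (hXε.solves ε hε),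
      hWε.solves ε hε,
      fun Y hY => hfam.solvesStripODE_eqOn hs hss₀.le hε hY (hWε.solves ε hε)⟩,
    fun ε hε => ⟨hXup ε hε, fun Y hY => huε.upwindODE_eqOn hδa hs₀.le hε hY (hXup ε hε),
      hWup ε hε, fun Y hY => huε.upwindODE_eqOn hδa hs₀.le hε hY (hWup ε hε)⟩,
    hXε.uniformlyBounded, hWε.uniformlyBounded, hX.holo, hW.holo,
    hXcl, fun Y hY x t ht => hY.eq_of_val hs hVM hVu hXcl x ht,
    hWcl, fun Y hY x t ht => hY.eq_of_val hs hVM hVu hWcl x ht,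
    hX'.convergesOnCompacts hs₁.le hX, hW'.convergesOnCompacts hs₁.le hW⟩

open WeakAsymptotic in
theorem mainTheorem3 (M : ℝ) (hM : 0 < M) :
    ∃ C : ℝ, 0 < C ∧
    ∀ (r s₀ a σ η B α : ℝ) (n : ℕ) (φ : ℝ → ℝ)
      (uε : ℝ → ℂ → ℂ → ℂ) (v₀ε w₀ε : ℝ → ℂ → ℂ)
      (u : ℝ → ℝ → ℝ) (v₀ w₀ : ℝ → ℂ),
      0 < s₀ → s₀ < r → 0 < a → (σ = 1 ∨ σ = -1) → 0 < η → 0 < α → α ≤ 1 →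
      ContDiff ℝ (⊤ : ℕ∞) φ → HasCompactSupport φ → (∫ y, φ y) = 1 →
      AnalyticCoefficient r s₀ a M σ η uε →
      AnalyticDatum r s₀ B v₀ε →
      AnalyticDatum r s₀ B w₀ε →
      (∀ t ∈ Set.Ico 0 a, ConvergesL1Torus (fun ε x => uε ε x t) (fun x => (u x t : ℂ))) →
      ConvergesL1Torus (fun ε x => v₀ε ε x) v₀ →
      ConvergesL1Torus (fun ε x => w₀ε ε x) w₀ →
      ∀ (s : ℝ) (hs : 0 < s), s < s₀ → ∀ δ : ℝ, δ = min a (C * (s₀ - s)) →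
      ∃ (Xε Wε : ℝ → ℂ → StripSpace s) (X W : ℂ → StripSpace s),
        -- existence and uniqueness of the holomorphic solutions, for each `ε`
        (∀ ε ∈ Set.Ioo (0 : ℝ) 1,
          SolvesStripODE σ ε δ (uε ε) (fun _ _ => 0) (v₀ε ε) (Xε ε) ∧
          (∀ Y : ℂ → StripSpace s,
            SolvesStripODE σ ε δ (uε ε) (fun _ _ => 0) (v₀ε ε) Y →
              Set.EqOn Y (Xε ε) (Metric.ball 0 δ)) ∧
          SolvesStripODE σ ε δ (uε ε)
            (fun z t => pressureGradC n φ (ε ^ α) (val (Xε ε t)) z) (w₀ε ε) (Wε ε) ∧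
          (∀ Y : ℂ → StripSpace s,
            SolvesStripODE σ ε δ (uε ε)
              (fun z t => pressureGradC n φ (ε ^ α) (val (Xε ε t)) z) (w₀ε ε) Y →
              Set.EqOn Y (Wε ε) (Metric.ball 0 δ))) ∧
        -- on the real axis they are the unique solutions of the ODEs in `C_b(ℝ)`
        (∀ ε ∈ Set.Ioo (0 : ℝ) 1,
          SolvesUpwindODE ε δ (fun x t => (uε ε x t).re) (fun _ _ => 0) (fun x => v₀ε ε x)
            (fun t => restrictReal hs (Xε ε t)) ∧
          (∀ Y : ℝ → BoundedContinuousFunction ℝ ℂ,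
            SolvesUpwindODE ε δ (fun x t => (uε ε x t).re) (fun _ _ => 0) (fun x => v₀ε ε x) Y →
              ∀ t ∈ Set.Ico 0 δ, Y t = restrictReal hs (Xε ε t)) ∧
          SolvesUpwindODE ε δ (fun x t => (uε ε x t).re)
            (fun x t => pressureGrad n φ (ε ^ α) (restrictReal hs (Xε ε t)) x)
              (fun x => w₀ε ε x)
            (fun t => restrictReal hs (Wε ε t)) ∧
          (∀ Y : ℝ → BoundedContinuousFunction ℝ ℂ,
            SolvesUpwindODE ε δ (fun x t => (uε ε x t).re)
              (fun x t => pressureGrad n φ (ε ^ α) (restrictReal hs (Xε ε t)) x)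
              (fun x => w₀ε ε x) Y →
              ∀ t ∈ Set.Ico 0 δ, Y t = restrictReal hs (Wε ε t))) ∧
        -- bounds uniform in `ε`
        UniformlyBounded δ Xε ∧ UniformlyBounded δ Wε ∧
        -- the classical analytic solution exists for the same time and is the only classical one
        DifferentiableOn ℂ X (Metric.ball 0 δ) ∧ DifferentiableOn ℂ W (Metric.ball 0 δ) ∧
        IsClassicalSolution δ u (fun _ _ => 0) v₀ (fun x t => val (X t) x) ∧
        (∀ Y : ℝ → ℝ → ℂ, IsClassicalSolution δ u (fun _ _ => 0) v₀ Y →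
          ∀ x : ℝ, ∀ t ∈ Set.Ico 0 δ, Y x t = val (X t) x) ∧
        IsClassicalSolution δ u (fun x t => deriv (fun ξ : ℝ => val (X t) ξ ^ n) x) w₀
          (fun x t => val (W t) x) ∧
        (∀ Y : ℝ → ℝ → ℂ,
          IsClassicalSolution δ u (fun x t => deriv (fun ξ : ℝ => val (X t) ξ ^ n) x) w₀ Y →
          ∀ x : ℝ, ∀ t ∈ Set.Ico 0 δ, Y x t = val (W t) x) ∧
        -- convergence
        ConvergesOnCompacts δ Xε X ∧ ConvergesOnCompacts δ Wε W := by
  refine ⟨1 / (8 * Real.exp 1 * M), by positivity, ?_⟩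
  rintro r s₀ a σ η B α n φ uε v₀ε w₀ε u v₀ w₀ - hr ha hσ hη hα - - - hφ huε hv₀ε hw₀ε hu hv₀ hw₀
    s hs hss₀ δ rfl
  have : 0 < s₀ - s := sub_pos.2 hss₀
  have hδ := min_le_right a (1 / (8 * Real.exp 1 * M) * (s₀ - s))
  rw [one_div_mul_eq_div, le_div_iff₀' (by positivity)] at hδ
  exact mainTheorem3_general n hr hσ hη.le hφ (fun ε hε => Real.rpow_pos_of_pos hε.1 α)
    (tendsto_rpow_nhdsGT_zero hα) huε hv₀ε hw₀ε hu hv₀ hw₀ hs hss₀ (by positivity)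
    (min_le_left _ _) (by rw [one_div_mul_eq_div]; linarith)
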